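/- Let $S\in\mathbb R^{n\times n}$ be symmetric and $K\in\mathbb N$. For a coefficient vector $h\in\mathbb R^K$ the graph filter is $f_x(h)=\sum_{k=0}^{K-1}h_kS^kx$, $x\in\mathbb R^n$, and the loss at $z=(x,y)\in\mathbb R^n\times\mathbb R^n$ is $\ell(h,z)=\|f_x(h)-y\|_2^2$. Let $\mathcal D$ be a probability distribution on $\mathbb R^n\times\mathbb R^n$ and let $\rho\ge 0$. Given a sample $\mathcal S=\{(x_i,y_i)\}_{i=1}^M$, $M\ge 1$, let $\tilde y=(y_1^{\sf T},\dots,y_M^{\sf T})^{\sf T}\in\mathbb R^{nM}$ and let $\tilde\Theta\in\mathbb R^{nM\times nM}$ be the neural tangent kernel matrix, whose $(i,j)$-th $n\times n$ block is $J_iJ_j^{\sf T}$ with $J_i=\partial f_{x_i}(h)/\partial h$. It does not depend on $h$; its $(i,j)$-th block is $\sum_{k<K}S^kx_i(S^kx_j)^{\sf T}$. Let $\tilde\Theta^\dagger$ be its Moore–Penrose pseudo-inverse. For a learning rate $\eta>0$ and an initialization $h^{(0)}\in\mathbb R^K$ let $h^{(t+1)}=h^{(t)}-\eta\nabla\Phi(h^{(t)})$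 be gradient descent on $\Phi(h)=\frac12\sum_{i=1}^M\|y_i-f_{x_i}(h)\|_2^2$, and let $\mathcal H_{trained}$ be the set of all $h^{(t)}$, $t=0,1,2,\dots$, together with the limit $h^{(\infty)}=\lim_t h^{(t)}$ if it exists. Write $L_{\mathcal D}(h)=\mathbb E_{z\sim\mathcal D}[\ell(h,z)]$ and $L_{\mathcal S}(h)=\frac1M\sum_{i=1}^M\ell(h,(x_i,y_i))$. There is a constant $\varepsilon>0$, depending only on $n,K,S,\mathcal D,\rho$, such that the following holds for all $M\ge1$, all $\delta_1,\delta_2>0$ with $\delta=\delta_1+\delta_2<1$ and all $0<\kappa\le\varepsilon\sqrt{\delta_1/(nM)}$. Let the sample $\mathcal S$ be drawn i.i.d. from $\mathcal D$ and, independently, $h^{(0)}\sim\mathcal N(0,\kappa^2I)$. Then with probability at least $1-\delta$, for every learning rate $\eta>0$ with $\eta\|\tilde\Theta\|_{op}\le1$: if every $h\in\mathcal H_{trained}$ satisfies $|\ell(h,z)|\le\rho^2$ for $\mathcal D$-almost every $z$, then every $h\in\mathcal H_{trained}$ satisfies $$L_{\mathcal D}(h)-L_{\mathcal S}(h)\le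 2\rho\sqrt{\frac{2K\cdot\big(\max_{0\le k<K,\,1\le i\le M}\|S^kx_i\|_2^2\big)\cdot\big(\tilde y^{\sf T}\tilde\Theta^\dagger\tilde y\big)}{M}}+4\rho^2\sqrt{\frac{2\ln(4/\delta_2)}{M}}.$$ In particular, this holds for any $h$ that minimizes $L_{\mathcal S}$ over $\mathcal H_{trained}$. -/

import Mathlib

open MeasureTheory ProbabilityTheory Filter Topology
open scoped Matrix ENNReal

noncomputable section

namespace GraphNTK

/-- Column vectors of length `n`, with the Euclidean norm. -/
abbrev Vec (n : ℕ) := EuclideanSpace ℝ (Fin n)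

/-! ### Moore–Penrose pseudo-inverse -/

/-- `B` satisfies the four Penrose equations for the real matrix `A`. -/
structure IsMoorePenrose {ι : Type*} [Fintype ι] (A B : Matrix ι ι ℝ) : Prop where
  mul_mul_self : A * B * A = A
  self_mul_mul : B * A * B = B
  symm_left : (A * B)ᵀ = A * B
  symm_right : (B * A)ᵀ = B * A

/-- The Penrose equations have at most one solution. -/
theorem IsMoorePenrose.unique {ι : Type*} [Fintype ι] {A B C : Matrix ι ι ℝ}
    (hB : IsMoorePenrose A B) (hC : IsMoorePenrose A C) : B = C := by
  have h1 : A * B = A * C := by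
    calc A * B = (A * B)ᵀ := hB.symm_left.symm
      _ = ((A * C) * (A * B))ᵀ := by
          rw [← Matrix.mul_assoc, hC.mul_mul_self]
      _ = (A * B) * (A * C) := by
          rw [Matrix.transpose_mul, hB.symm_left, hC.symm_left]
      _ = A * C := by rw [← Matrix.mul_assoc, hB.mul_mul_self]
  have h2 : B * A = C * A := by
    calc B * A = (B * A)ᵀ := hB.symm_right.symm
      _ = ((B * A) * (C * A))ᵀ := by
          rw [Matrix.mul_assoc, ← Matrix.mul_assoc A, hC.mul_mul_self]
      _ = (C * A) * (B * A) := by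
          rw [Matrix.transpose_mul, hB.symm_right, hC.symm_right]
      _ = C * A := by rw [Matrix.mul_assoc, ← Matrix.mul_assoc A, hB.mul_mul_self]
  calc B = B * A * B := hB.self_mul_mul.symm
    _ = C * A * C := by rw [h2, Matrix.mul_assoc, h1, ← Matrix.mul_assoc]
    _ = C := hC.self_mul_mul

open Classical in
/-- The Moore–Penrose pseudo-inverse `A†`. -/
def pinv {ι : Type*} [Fintype ι] (A : Matrix ι ι ℝ) : Matrix ι ι ℝ :=
  if h : ∃ B, IsMoorePenrose A B then h.choose else 0

/-- For a symmetric real matrix the pseudo-inverse exists. -/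
theorem isMoorePenrose_pinv {ι : Type*} [Fintype ι] [DecidableEq ι] {A : Matrix ι ι ℝ}
    (hA : A.IsHermitian) : IsMoorePenrose A (pinv A) := by
  have h : ∃ B, IsMoorePenrose A B := by
    set U : Matrix ι ι ℝ := (hA.eigenvectorUnitary : Matrix ι ι ℝ) with hU
    set d : ι → ℝ := hA.eigenvalues
    have hUU : Uᵀ * U = 1 := by
      have := Unitary.coe_star_mul_self hA.eigenvectorUnitary
      simpa [Matrix.star_eq_conjTranspose, Matrix.conjTranspose_eq_transpose_of_trivial] using this
    have hAeq : A = U * Matrix.diagonal d * Uᵀ := by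
      have := hA.spectral_theorem
      rw [Unitary.conjStarAlgAut_apply] at this
      simpa [Matrix.star_eq_conjTranspose, Matrix.conjTranspose_eq_transpose_of_trivial,
        Function.comp_def] using this
    have key : ∀ a b : ι → ℝ, (U * Matrix.diagonal a * Uᵀ) * (U * Matrix.diagonal b * Uᵀ)
        = U * Matrix.diagonal (fun i => a i * b i) * Uᵀ := by
      intro a b
      rw [← Matrix.diagonal_mul_diagonal]
      calc (U * Matrix.diagonal a * Uᵀ) * (U * Matrix.diagonal b * Uᵀ)
          = U * Matrix.diagonal a * (Uᵀ * U) * Matrix.diagonal b * Uᵀ := by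
            simp only [Matrix.mul_assoc]
        _ = _ := by rw [hUU]; simp only [Matrix.mul_assoc, Matrix.mul_one]
    have sym : ∀ a : ι → ℝ, (U * Matrix.diagonal a * Uᵀ)ᵀ = U * Matrix.diagonal a * Uᵀ := by
      intro a
      simp [Matrix.transpose_mul, Matrix.mul_assoc]
    refine ⟨U * Matrix.diagonal (fun i => (d i)⁻¹) * Uᵀ, ?_, ?_, ?_, ?_⟩
    · rw [hAeq, key, key]
      simp
    · rw [hAeq, key, key]
      congr 3
      ext i
      by_cases hi : d i = 0 <;> simp [hi]
    · rw [hAeq, key, sym]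
    · rw [hAeq, key, sym]
  rw [pinv, dif_pos h]
  exact h.choose_spec

/-! ### Predictors, neural tangent kernel, gradient descent

A predictor `f` with `p` parameters sends an input `x` and a parameter vector `h` to
`f x h`.  A data set of size `M` is a function `z : Fin M → Vec n × Vec n`, with
`z i = (xᵢ, yᵢ)`. -/

/-- Jacobian matrix of `F` at `h`, with entries `∂ F_a / ∂ h_b`. -/
def jacobian {p n : ℕ} (F : Vec p → Vec n) (h : Vec p) : Matrix (Fin n) (Fin p) ℝ :=
  Matrix.of fun a b => (fderiv ℝ F h (EuclideanSpace.single b 1)) a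

/-- The NTK matrix at the parameters `h`: an `nM × nM` matrix whose `(i, j)` block is
`J_{f_{xᵢ}}(h) J_{f_{xⱼ}}(h)ᵀ`. -/
def ntk {p n M : ℕ} (f : Vec n → Vec p → Vec n) (z : Fin M → Vec n × Vec n) (h : Vec p) :
    Matrix (Fin M × Fin n) (Fin M × Fin n) ℝ :=
  Matrix.of fun u v =>
    (jacobian (f (z u.1).1) h * (jacobian (f (z v.1).1) h)ᵀ) u.2 v.2

theorem ntk_isHermitian {p n M : ℕ} (f : Vec n → Vec p → Vec n) (z : Fin M → Vec n × Vec n)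
    (h : Vec p) : (ntk f z h).IsHermitian := by
  ext u v
  simp [ntk, Matrix.mul_apply, mul_comm]

/-- The stacked outputs `ỹ`, a vector of length `nM`. -/
def stackedOutput {n M : ℕ} (z : Fin M → Vec n × Vec n) : Fin M × Fin n → ℝ :=
  fun u => (z u.1).2 u.2

/-- The training objective `Φ(h) = ½ ∑ᵢ ‖yᵢ - f_{xᵢ}(h)‖²`. -/
def objective {p n M : ℕ} (f : Vec n → Vec p → Vec n) (z : Fin M → Vec n × Vec n)
    (h : Vec p) : ℝ :=
  (1 / 2) * ∑ i, ‖(z i).2 - f (z i).1 h‖ ^ 2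

/-- Gradient descent on the training objective with learning rate `η`, started at `h₀`. -/
def gdIterate {p n M : ℕ} (f : Vec n → Vec p → Vec n) (z : Fin M → Vec n × Vec n)
    (η : ℝ) (h₀ : Vec p) : ℕ → Vec p
  | 0 => h₀
  | t + 1 => gdIterate f z η h₀ t - η • gradient (objective f z) (gdIterate f z η h₀ t)

/-- Parameters reached from `h₀` by gradient descent, after finitely many steps or in the
limit of infinitely many steps. -/
def trained {p n M : ℕ} (f : Vec n → Vec p → Vec n) (z : Fin M → Vec n × Vec n)
    (η : ℝ) (h₀ : Vec p) : Set (Vec p) :=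
  {h | (∃ t, h = gdIterate f z η h₀ t) ∨ Tendsto (gdIterate f z η h₀) atTop (𝓝 h)}

/-! ### Graph filters -/

/-- `S^k x`. -/
def shiftPow {n : ℕ} (S : Matrix (Fin n) (Fin n) ℝ) (k : ℕ) (x : Vec n) : Vec n :=
  WithLp.toLp 2 ((S ^ k) *ᵥ x.ofLp)

/-- The graph filter with shift operator `S` and `K` taps: `f_x(h) = ∑_{k<K} h_k S^k x`. -/
def graphFilter {n : ℕ} (K : ℕ) (S : Matrix (Fin n) (Fin n) ℝ) (x : Vec n) (h : Vec K) :
    Vec n :=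
  ∑ k : Fin K, h k • shiftPow S k x

/-- The NTK of a graph filter does not depend on the parameters: its `(i, j)` block is
`∑_{k<K} S^k xᵢ (S^k xⱼ)ᵀ`. -/
theorem ntk_graphFilter {n M : ℕ} (K : ℕ) (S : Matrix (Fin n) (Fin n) ℝ)
    (z : Fin M → Vec n × Vec n) (h : Vec K) (u v : Fin M × Fin n) :
    ntk (graphFilter K S) z h u v =
      ∑ k : Fin K, shiftPow S k (z u.1).1 u.2 * shiftPow S k (z v.1).1 v.2 := by
  have hd : ∀ x : Vec n, HasFDerivAt (graphFilter K S x)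
      (∑ k : Fin K, (EuclideanSpace.proj k : Vec K →L[ℝ] ℝ).smulRight
        (shiftPow S k x)) h := by
    intro x
    have : graphFilter K S x = ⇑(∑ k : Fin K,
        (EuclideanSpace.proj k : Vec K →L[ℝ] ℝ).smulRight
          (shiftPow S k x)) := by
      ext g
      simp [graphFilter]
    rw [this]
    exact ContinuousLinearMap.hasFDerivAt _
  simp only [ntk, Matrix.of_apply, Matrix.mul_apply, jacobian, Matrix.transpose_apply,
    (hd _).fderiv]
  refine Finset.sum_congr rfl fun k _ => ?_
  simp

/-- The quadratic loss `ℓ(h, (x, y)) = ‖f_x(h) - y‖²`. -/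
def loss {n K : ℕ} (S : Matrix (Fin n) (Fin n) ℝ) (h : Vec K) (z : Vec n × Vec n) : ℝ :=
  ‖graphFilter K S z.1 h - z.2‖ ^ 2

/-- Population loss. -/
def popLoss {n K : ℕ} (S : Matrix (Fin n) (Fin n) ℝ) (D : Measure (Vec n × Vec n))
    (h : Vec K) : ℝ :=
  ∫ z, loss S h z ∂D

/-- Sample loss. -/
def sampleLoss {n K M : ℕ} (S : Matrix (Fin n) (Fin n) ℝ) (z : Fin M → Vec n × Vec n)
    (h : Vec K) : ℝ :=
  (1 / (M : ℝ)) * ∑ i, loss S h (z i)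

/-- `max_{k<K, i} ‖S^k xᵢ‖²`, a maximum over a finite set. -/
def maxShiftSq {n M : ℕ} (K : ℕ) (S : Matrix (Fin n) (Fin n) ℝ)
    (z : Fin M → Vec n × Vec n) : ℝ :=
  ⨆ q : Fin K × Fin M, ‖shiftPow S q.1 (z q.2).1‖ ^ 2

/-- The law `N(0, κ² I)` of the initial filter coefficients. -/
def initLaw (K : ℕ) (κ : ℝ) : Measure (Vec K) :=
  multivariateGaussian 0 (κ ^ 2 • (1 : Matrix (Fin K) (Fin K) ℝ))

/-- The generalization bound
`2ρ √(2K · max_{k,i} ‖S^k xᵢ‖² · (ỹᵀ Θ̃† ỹ) / M) + 4ρ² √(2 ln(4/δ₂) / M)`. -/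
def genBound {n M : ℕ} (K : ℕ) (S : Matrix (Fin n) (Fin n) ℝ) (ρ δ₂ : ℝ)
    (z : Fin M → Vec n × Vec n) (Θ : Matrix (Fin M × Fin n) (Fin M × Fin n) ℝ) : ℝ :=
  2 * ρ * √(2 * K * maxShiftSq K S z * (stackedOutput z ⬝ᵥ (pinv Θ *ᵥ stackedOutput z)) / M)
    + 4 * ρ ^ 2 * √(2 * Real.log (4 / δ₂) / M)

end GraphNTK

end

/-! A graph filter is linear in its coefficients, so training is explicit. Let `A` be the stacked
feature matrix, so that the kernel is Θ̃ = AAᵀ. The vector v = AᵀΘ̃†ỹ solves the normal equations,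
and ‖v‖² = ỹᵀΘ̃†ỹ. If η‖Θ̃‖ ≤ 1, then in an eigenbasis of AᵀA every coordinate of an iterate is a
convex combination of the coordinates of h₀ and v. Hence ‖h‖ ≤ ‖h₀‖ + ‖v‖ along the whole trajectory
and in the limit (`norm_trained_le`).

It remains to bound the deviation uniformly over admissible `h` in terms of ‖h‖. This is a PAC-Bayes
argument with a standard Gaussian prior and, as posterior, its translate by `h`, at the price ‖h‖²/2
(`ofReal_exp_integral_add_le`). Gaussian noise in the coefficients raises the square loss on average
by exactly ∑ₖ‖Sᵏx‖², so subtracting this sum makes the noisy loss unbiased. The corrected loss is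
bounded below, which controls its exponential moment, and its second moment under the posterior is
bounded wherever the loss of `h` is (`measure_pacBayes_le`). A union bound over dyadic sizes of ‖h‖²
tunes the temperature (`exists_scale`).

The features have to be normalized by a deterministic number, while the claim involves a sample
maximum. A quantile `t` of ∑ₖ‖Sᵏx‖² serves both purposes: with high probability some sample point
reaches `t`, and the mass above `t` is O(log(1/δ₂)/M), so those data can be discarded
(`exists_uniform_deviation`).

The probability δ₁ pays for a large ‖h₀‖ and δ₂ for the sample. If the features or the outputs are
unbounded, h₀ is almost surely, respectively always, inadmissible, and the claim is vacuous
(`initLaw_admissible_eq_zero`, `ae_bound_output`). -/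

noncomputable section

namespace GraphNTK

open scoped RealInnerProductSpace

/-! ### Gaussian integrals and change of measure -/

theorem integral_pow_four_gaussianReal : ∫ x, x ^ 4 ∂(gaussianReal 0 1) = 3 := by
  rw [integral_gaussianReal_eq_integral_smul one_ne_zero]
  have h1 : ∀ x : ℝ, gaussianPDFReal 0 1 x • x ^ 4
      = (√(2 * Real.pi))⁻¹ * ((fun r : ℝ => r ^ 4 * Real.exp (-(1 / 2) * r ^ 2)) |x|) := by
    intro x
    simp only [gaussianPDFReal, NNReal.coe_one, mul_one, sub_zero, smul_eq_mul, sq_abs]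
    rw [Even.pow_abs (by decide)]
    ring_nf
  simp_rw [h1]
  rw [integral_const_mul, integral_comp_abs (f := fun r : ℝ => r ^ 4 * Real.exp (-(1 / 2) * r ^ 2))]
  have h2 : ∫ x in Set.Ioi (0 : ℝ), x ^ 4 * Real.exp (-(1 / 2) * x ^ 2)
      = (1 / 2 : ℝ) ^ (-(5 / 2 : ℝ)) * (1 / 2) * Real.Gamma (5 / 2) := by
    have := integral_rpow_mul_exp_neg_mul_rpow (p := 2) (q := 4) (b := 1 / 2)
      (by norm_num) (by norm_num) (by norm_num)
    norm_num at this ⊢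
    exact this
  have h3 : Real.Gamma (5 / 2) = 3 / 4 * √Real.pi := by
    rw [show (5 / 2 : ℝ) = 3 / 2 + 1 by norm_num, Real.Gamma_add_one (by norm_num),
      show (3 / 2 : ℝ) = 1 / 2 + 1 by norm_num, Real.Gamma_add_one (by norm_num),
      Real.Gamma_one_half_eq]
    ring
  have h4 : (1 / 2 : ℝ) ^ (-(5 / 2 : ℝ)) = 4 * √2 := by
    rw [one_div, Real.inv_rpow (by norm_num), Real.rpow_neg (by norm_num), inv_inv,
      show (5 / 2 : ℝ) = 2 + 1 / 2 by norm_num, Real.rpow_add (by norm_num), Real.sqrt_eq_rpow]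
    norm_num
  rw [h2, h3, h4, Real.sqrt_mul (by norm_num)]
  have : √2 ≠ 0 := by positivity
  have : √Real.pi ≠ 0 := by positivity
  field_simp

/-- The density of the standard Gaussian law. -/
theorem stdGaussian_eq_withDensity (K : ℕ) : stdGaussian (Vec K) =
    volume.withDensity (fun x => ENNReal.ofReal
      ((2 * Real.pi) ^ (-(K / 2 : ℝ)) * Real.exp (-(1 / 2) * ‖x‖ ^ 2))) := by
  have hint : ∫ x : Vec K, Real.exp (-(1 / 2) * ‖x‖ ^ 2) = (2 * Real.pi) ^ (K / 2 : ℝ) := by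
    have := GaussianFourier.integral_rexp_neg_mul_sq_norm (V := Vec K) (b := 1 / 2) (by norm_num)
    rw [this]
    simp
    ring_nf
  have hI : Integrable (fun x : Vec K => Real.exp (-(1 / 2) * ‖x‖ ^ 2)) := by
    refine Integrable.of_integral_ne_zero ?_
    rw [hint]; positivity
  have hfin : IsFiniteMeasure (volume.withDensity (fun x : Vec K => ENNReal.ofReal
      ((2 * Real.pi) ^ (-(K / 2 : ℝ)) * Real.exp (-(1 / 2) * ‖x‖ ^ 2)))) :=
    isFiniteMeasure_withDensity_ofReal (hI.const_mul _).2
  -- Both measures are finite, so it suffices to compare characteristic functions.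
  apply Measure.ext_of_charFun
  ext t
  rw [charFun_stdGaussian, charFun_apply,
    integral_withDensity_eq_integral_toReal_smul (by fun_prop) (by simp)]
  have h1 : ∀ x : Vec K, (ENNReal.ofReal ((2 * Real.pi) ^ (-(K / 2 : ℝ)) *
      Real.exp (-(1 / 2) * ‖x‖ ^ 2))).toReal • Complex.exp (⟪x, t⟫ * Complex.I)
      = (((2 * Real.pi) ^ (-(K / 2 : ℝ)) : ℝ) : ℂ) *
        Complex.exp (-(1 / 2 : ℂ) * ‖x‖ ^ 2 + Complex.I * ⟪t, x⟫) := by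
    intro x
    rw [ENNReal.toReal_ofReal (by positivity), Complex.exp_add, real_inner_comm]
    simp only [Complex.real_smul]
    push_cast
    ring_nf
  simp_rw [h1]
  rw [integral_const_mul, GaussianFourier.integral_cexp_neg_mul_sq_norm_add (by norm_num)]
  have h2 : ((Real.pi : ℂ) / (1 / 2)) ^ ((Module.finrank ℝ (Vec K) : ℂ) / 2)
      = (((2 * Real.pi) ^ (K / 2 : ℝ) : ℝ) : ℂ) := by
    rw [Complex.ofReal_cpow (by positivity)]
    simp
    ring_nf
  rw [h2, ← mul_assoc, ← Complex.ofReal_mul, ← Real.rpow_add (by positivity)]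
  simp
  ring_nf

theorem integral_inner_sq_stdGaussian {K : ℕ} (a : Vec K) :
    ∫ x, ⟪a, x⟫ ^ 2 ∂(stdGaussian (Vec K)) = ‖a‖ ^ 2 := by
  have h := variance_dual_stdGaussian (innerSL ℝ a)
  rw [variance_of_integral_eq_zero (by fun_prop) (integral_strongDual_stdGaussian _)] at h
  simpa using h

theorem map_inner_stdGaussian {K : ℕ} (a : Vec K) :
    (stdGaussian (Vec K)).map (fun x => ⟪a, x⟫) = gaussianReal 0 (‖a‖₊ ^ 2) := by
  have h := IsGaussian.map_eq_gaussianReal (μ := stdGaussian (Vec K)) (innerSL ℝ a)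
  rw [integral_strongDual_stdGaussian, variance_dual_stdGaussian] at h
  simp at h
  rw [h]
  congr 1
  ext
  simp

theorem integral_inner_pow_four_stdGaussian {K : ℕ} (a : Vec K) :
    ∫ x, ⟪a, x⟫ ^ 4 ∂(stdGaussian (Vec K)) = 3 * ‖a‖ ^ 4 := by
  have h1 : ∫ x, ⟪a, x⟫ ^ 4 ∂(stdGaussian (Vec K))
      = ∫ y, y ^ 4 ∂((stdGaussian (Vec K)).map (fun x => ⟪a, x⟫)) := by
    rw [integral_map (by fun_prop) (by fun_prop)]
  have h2 : gaussianReal 0 (‖a‖₊ ^ 2) = (gaussianReal 0 1).map (fun x => ‖a‖ * x) := by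
    rw [gaussianReal_map_const_mul]
    congr 1
    · simp
    · ext; simp
  rw [h1, map_inner_stdGaussian, h2, integral_map (by fun_prop) (by fun_prop)]
  simp_rw [mul_pow]
  rw [integral_const_mul, integral_pow_four_gaussianReal]
  ring

theorem ofReal_integral_le_lintegral_ofReal {α : Type*} {m : MeasurableSpace α} {μ : Measure α}
    (f : α → ℝ) : ENNReal.ofReal (∫ x, f x ∂μ) ≤ ∫⁻ x, ENNReal.ofReal (f x) ∂μ := by
  by_cases hf : Integrable f μ
  · rw [integral_eq_lintegral_pos_part_sub_lintegral_neg_part hf]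
    refine (ENNReal.ofReal_le_ofReal (sub_le_self _ ENNReal.toReal_nonneg)).trans ?_
    exact ENNReal.ofReal_toReal_le
  · simp [integral_undef hf]

/-- Jensen's inequality, from the tangent line of exp at the mean. Working with the lower Lebesgue
integral on the right avoids assuming that exp ∘ f is integrable. -/
theorem ofReal_exp_integral_le {α : Type*} {m : MeasurableSpace α} {μ : Measure α}
    [IsProbabilityMeasure μ] {f : α → ℝ} (hf : Integrable f μ) :
    ENNReal.ofReal (Real.exp (∫ x, f x ∂μ)) ≤ ∫⁻ x, ENNReal.ofReal (Real.exp (f x)) ∂μ := by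
  set c := ∫ x, f x ∂μ with hc
  have h1 : ∫ x, Real.exp c * (1 + (f x - c)) ∂μ = Real.exp c := by
    rw [integral_const_mul, integral_add (integrable_const _) (by exact hf.sub (integrable_const _)),
      integral_sub hf (integrable_const _)]
    simp [← hc]
  calc ENNReal.ofReal (Real.exp c) = ENNReal.ofReal (∫ x, Real.exp c * (1 + (f x - c)) ∂μ) := by
        rw [h1]
    _ ≤ ∫⁻ x, ENNReal.ofReal (Real.exp c * (1 + (f x - c))) ∂μ :=
        ofReal_integral_le_lintegral_ofReal _
    _ ≤ _ := by
        refine lintegral_mono fun x => ENNReal.ofReal_le_ofReal ?_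
        have h2 := Real.add_one_le_exp (f x - c)
        calc Real.exp c * (1 + (f x - c)) ≤ Real.exp c * Real.exp (f x - c) := by
              gcongr; linarith
          _ = _ := by rw [← Real.exp_add]; ring_nf

/-- Change of measure for a shifted standard Gaussian: the shift by `h` costs `‖h‖² / 2`. -/
theorem ofReal_exp_integral_add_le {K : ℕ} (h : Vec K) {F : Vec K → ℝ} (hF : Measurable F)
    (hI : Integrable (fun x => F (h + x)) (stdGaussian (Vec K))) :
    ENNReal.ofReal (Real.exp (∫ x, F (h + x) ∂(stdGaussian (Vec K)) - ‖h‖ ^ 2 / 2)) ≤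
      ∫⁻ w, ENNReal.ofReal (Real.exp (F w)) ∂(stdGaussian (Vec K)) := by
  have hL : Integrable (fun x : Vec K => ⟪h, x⟫) (stdGaussian (Vec K)) := by
    simpa using IsGaussian.integrable_dual (stdGaussian (Vec K)) (innerSL ℝ h)
  have hL0 : ∫ x, ⟪h, x⟫ ∂(stdGaussian (Vec K)) = 0 := by
    simpa using integral_strongDual_stdGaussian (innerSL ℝ h)
  -- The last two terms are the logarithm of the density ratio between the prior at h + x and at x.
  -- Jensen applied to `f` then gives the Gaussian case of the Donsker–Varadhan inequality.
  set f : Vec K → ℝ := fun x => F (h + x) - ⟪h, x⟫ - ‖h‖ ^ 2 / 2 with hf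
  have hfI : Integrable f (stdGaussian (Vec K)) := (hI.sub hL).sub (integrable_const _)
  have e1 : ∫ x, f x ∂(stdGaussian (Vec K))
      = ∫ x, F (h + x) ∂(stdGaussian (Vec K)) - ‖h‖ ^ 2 / 2 := by
    simp only [hf]
    rw [integral_sub (by exact hI.sub hL) (integrable_const _), integral_sub hI hL, hL0]
    simp
  have e2 : ∫⁻ x, ENNReal.ofReal (Real.exp (f x)) ∂(stdGaussian (Vec K))
      = ∫⁻ w, ENNReal.ofReal (Real.exp (F w)) ∂(stdGaussian (Vec K)) := by
    rw [stdGaussian_eq_withDensity, lintegral_withDensity_eq_lintegral_mul _ (by fun_prop)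
      (by fun_prop), lintegral_withDensity_eq_lintegral_mul _ (by fun_prop) (by fun_prop)]
    conv_rhs => rw [← lintegral_add_left_eq_self _ h]
    refine lintegral_congr fun x => ?_
    simp only [Pi.mul_apply, hf]
    rw [← ENNReal.ofReal_mul (by positivity), ← ENNReal.ofReal_mul (by positivity), mul_assoc,
      mul_assoc, ← Real.exp_add, ← Real.exp_add, norm_add_sq_real]
    ring_nf
  rw [← e1, ← e2]
  exact ofReal_exp_integral_le hfI

/-! ### Moments of a linear predictor under Gaussian noise -/

/-- The linear combination `∑ₖ wₖ vₖ`. -/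
def comb {n K : ℕ} (v : Fin K → Vec n) (w : Vec K) : Vec n := ∑ k, w k • v k

/-- The total square size `∑ₖ ‖vₖ‖²`. -/
def sqSize {n K : ℕ} (v : Fin K → Vec n) : ℝ := ∑ k, ‖v k‖ ^ 2

section comb

variable {n K : ℕ} (v : Fin K → Vec n)

theorem sqSize_nonneg : 0 ≤ sqSize v := Finset.sum_nonneg fun _ _ => sq_nonneg _

theorem comb_add (w w' : Vec K) : comb v (w + w') = comb v w + comb v w' := by
  simp [comb, add_smul, Finset.sum_add_distrib]

theorem comb_neg (w : Vec K) : comb v (-w) = -comb v w := by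
  simp [comb]

theorem comb_smul (c : ℝ) (w : Vec K) : comb v (c • w) = c • comb v w := by
  simp [comb, Finset.smul_sum, smul_smul]

@[fun_prop]
theorem continuous_comb : Continuous fun w => comb v w := by
  unfold comb
  fun_prop

theorem inner_comb (f : Vec n) (w : Vec K) :
    ⟪f, comb v w⟫ = ⟪(WithLp.toLp 2 fun k => ⟪f, v k⟫ : Vec K), w⟫ := by
  simp [comb, inner_sum, PiLp.inner_apply, inner_smul_right]

theorem comb_apply (w : Vec K) (a : Fin n) :
    comb v w a = ⟪(WithLp.toLp 2 fun k => v k a : Vec K), w⟫ := by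
  simp [comb, PiLp.inner_apply]

theorem norm_comb_sq_le (w : Vec K) : ‖comb v w‖ ^ 2 ≤ sqSize v * ‖w‖ ^ 2 := by
  have h1 : ‖comb v w‖ ≤ ∑ k, ‖v k‖ * |w k| := by
    refine (norm_sum_le _ _).trans (Finset.sum_le_sum fun k _ => ?_)
    rw [norm_smul, Real.norm_eq_abs, mul_comm]
  have h2 := Finset.sum_mul_sq_le_sq_mul_sq Finset.univ (fun k => ‖v k‖) (fun k => |w k|)
  calc ‖comb v w‖ ^ 2 ≤ (∑ k, ‖v k‖ * |w k|) ^ 2 := by gcongr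
    _ ≤ _ := h2
    _ = _ := by simp [sqSize, EuclideanSpace.real_norm_sq_eq]

theorem norm_toLp_inner_sq_le (f : Vec n) :
    ‖(WithLp.toLp 2 fun k => ⟪f, v k⟫ : Vec K)‖ ^ 2 ≤ ‖f‖ ^ 2 * sqSize v := by
  rw [EuclideanSpace.real_norm_sq_eq, sqSize, Finset.mul_sum]
  refine Finset.sum_le_sum fun k _ => ?_
  rw [← mul_pow]
  exact sq_le_sq' (by linarith [neg_le_of_abs_le (abs_real_inner_le_norm f (v k))])
    (real_inner_le_norm _ _)

theorem sum_norm_toLp_apply_sq :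
    ∑ a, ‖(WithLp.toLp 2 fun k => v k a : Vec K)‖ ^ 2 = sqSize v := by
  simp_rw [EuclideanSpace.real_norm_sq_eq, sqSize]
  rw [Finset.sum_comm]
  simp [EuclideanSpace.real_norm_sq_eq]

theorem integrable_of_bound_pow_four {f : Vec K → ℝ} (hf : AEStronglyMeasurable f (stdGaussian (Vec K))) (C : ℝ)
    (hC : ∀ x, |f x| ≤ C * (1 + ‖x‖ ^ 4)) : Integrable f (stdGaussian (Vec K)) := by
  have h4 : Integrable (fun x : Vec K => ‖x‖ ^ 4) (stdGaussian (Vec K)) :=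
    (IsGaussian.memLp_id (stdGaussian (Vec K)) 4 (by norm_num)).integrable_norm_pow (p := 4)
      (by norm_num)
  refine Integrable.mono' (((integrable_const 1).add h4).const_mul C) hf ?_
  filter_upwards with x
  simpa using hC x

theorem sq_le_one_add_pow_four (t : ℝ) : t ^ 2 ≤ 1 + t ^ 4 := by
  nlinarith [sq_nonneg (t ^ 2 - 1 / 2)]

theorem integrable_inner_comb_sq (f : Vec n) :
    Integrable (fun x => ⟪f, comb v x⟫ ^ 2) (stdGaussian (Vec K)) := by
  simp_rw [inner_comb]
  set L : Vec K := WithLp.toLp 2 fun k => ⟪f, v k⟫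
  refine integrable_of_bound_pow_four (by fun_prop) (‖L‖ ^ 2) fun x => ?_
  rw [abs_of_nonneg (sq_nonneg _)]
  calc ⟪L, x⟫ ^ 2 ≤ (‖L‖ * ‖x‖) ^ 2 := sq_le_sq.2 (by
        rw [abs_of_nonneg (by positivity : 0 ≤ ‖L‖ * ‖x‖)]; exact abs_real_inner_le_norm _ _)
    _ ≤ _ := by rw [mul_pow]; gcongr; exact sq_le_one_add_pow_four _

theorem integrable_norm_comb_pow_four :
    Integrable (fun x => ‖comb v x‖ ^ 4) (stdGaussian (Vec K)) := by
  refine integrable_of_bound_pow_four (by fun_prop) (sqSize v ^ 2) fun x => ?_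
  rw [abs_of_nonneg (by positivity)]
  have := norm_comb_sq_le v x
  calc ‖comb v x‖ ^ 4 = (‖comb v x‖ ^ 2) ^ 2 := by ring
    _ ≤ (sqSize v * ‖x‖ ^ 2) ^ 2 := by gcongr
    _ = sqSize v ^ 2 * ‖x‖ ^ 4 := by ring
    _ ≤ _ := by gcongr; linarith

theorem integrable_norm_comb_sq :
    Integrable (fun x => ‖comb v x‖ ^ 2) (stdGaussian (Vec K)) := by
  refine integrable_of_bound_pow_four (by fun_prop) (sqSize v) fun x => ?_
  rw [abs_of_nonneg (by positivity)]
  refine (norm_comb_sq_le v x).trans ?_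
  gcongr
  · exact sqSize_nonneg v
  · exact sq_le_one_add_pow_four _

theorem integrable_inner_comb (f : Vec n) :
    Integrable (fun x => ⟪f, comb v x⟫) (stdGaussian (Vec K)) := by
  simp_rw [inner_comb]
  simpa using IsGaussian.integrable_dual (stdGaussian (Vec K)) (innerSL ℝ _)

theorem integrable_inner_comb_mul_norm_sq (f : Vec n) :
    Integrable (fun x => ⟪f, comb v x⟫ * ‖comb v x‖ ^ 2) (stdGaussian (Vec K)) := by
  refine Integrable.mono' ((integrable_inner_comb_sq v f).add (integrable_norm_comb_pow_four v))
    (by fun_prop) ?_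
  filter_upwards with x
  rw [Real.norm_eq_abs, abs_le]
  constructor <;> simp only [Pi.add_apply] <;>
    nlinarith [sq_nonneg (⟪f, comb v x⟫ + ‖comb v x‖ ^ 2),
      sq_nonneg (⟪f, comb v x⟫ - ‖comb v x‖ ^ 2)]

theorem integral_inner_comb (f : Vec n) :
    ∫ x, ⟪f, comb v x⟫ ∂(stdGaussian (Vec K)) = 0 := by
  simp_rw [inner_comb]
  simpa using integral_strongDual_stdGaussian (innerSL ℝ _)

theorem integral_inner_comb_sq_le (f : Vec n) :
    ∫ x, ⟪f, comb v x⟫ ^ 2 ∂(stdGaussian (Vec K)) ≤ ‖f‖ ^ 2 * sqSize v := by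
  simp_rw [inner_comb]
  rw [integral_inner_sq_stdGaussian]
  exact norm_toLp_inner_sq_le v f

theorem integral_norm_comb_sq :
    ∫ x, ‖comb v x‖ ^ 2 ∂(stdGaussian (Vec K)) = sqSize v := by
  simp_rw [EuclideanSpace.real_norm_sq_eq, comb_apply]
  rw [integral_finsetSum]
  · simp_rw [integral_inner_sq_stdGaussian, sum_norm_toLp_apply_sq]
  · intro a _
    refine Integrable.mono' (integrable_norm_comb_sq v) (by fun_prop) ?_
    filter_upwards with x
    rw [← comb_apply, EuclideanSpace.real_norm_sq_eq, Real.norm_eq_abs,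
      abs_of_nonneg (sq_nonneg _)]
    exact Finset.single_le_sum (f := fun a => comb v x a ^ 2) (fun _ _ => sq_nonneg _)
      (Finset.mem_univ a)

/-- Each coordinate of `comb v x` is a centred Gaussian of variance ‖rₐ‖², where rₐ is a row of `v`.
Cauchy–Schwarz with weights ‖rₐ‖² reduces the claim to one-dimensional fourth moments, and the
factor 3 is the Gaussian kurtosis. -/
theorem integral_norm_comb_pow_four_le :
    ∫ x, ‖comb v x‖ ^ 4 ∂(stdGaussian (Vec K)) ≤ 3 * sqSize v ^ 2 := by
  set r : Fin n → Vec K := fun a => WithLp.toLp 2 fun k => v k a with hr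
  have hI : ∀ a, Integrable (fun x : Vec K => ⟪r a, x⟫ ^ 4 / ‖r a‖ ^ 2) (stdGaussian (Vec K)) := by
    intro a
    refine Integrable.div_const ?_ _
    refine Integrable.mono' (integrable_norm_comb_pow_four v) (by fun_prop) ?_
    filter_upwards with x
    rw [hr, ← comb_apply, Real.norm_eq_abs, abs_of_nonneg (by positivity)]
    have := Finset.single_le_sum (f := fun a => comb v x a ^ 2) (fun _ _ => sq_nonneg _)
      (Finset.mem_univ a)
    rw [← EuclideanSpace.real_norm_sq_eq] at this
    calc comb v x a ^ 4 = (comb v x a ^ 2) ^ 2 := by ring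
      _ ≤ (‖comb v x‖ ^ 2) ^ 2 := by gcongr
      _ = _ := by ring
  have hpt : ∀ x, ‖comb v x‖ ^ 4 ≤ sqSize v * ∑ a, ⟪r a, x⟫ ^ 4 / ‖r a‖ ^ 2 := by
    intro x
    rw [show ‖comb v x‖ ^ 4 = (‖comb v x‖ ^ 2) ^ 2 by ring, EuclideanSpace.real_norm_sq_eq,
      ← sum_norm_toLp_apply_sq]
    refine Finset.sum_sq_le_sum_mul_sum_of_sq_le_mul _ (fun _ _ => by positivity)
      (fun _ _ => by positivity) fun a _ => ?_
    refine le_of_eq ?_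
    rw [comb_apply]
    change (⟪r a, x⟫ ^ 2) ^ 2 = ‖r a‖ ^ 2 * (⟪r a, x⟫ ^ 4 / ‖r a‖ ^ 2)
    -- For a zero row the quotient is 0 by convention, and the coordinate vanishes as well.
    by_cases h0 : r a = 0
    · simp [h0]
    · have : ‖r a‖ ≠ 0 := by simpa using h0
      field_simp
  calc ∫ x, ‖comb v x‖ ^ 4 ∂(stdGaussian (Vec K))
      ≤ ∫ x, sqSize v * ∑ a, ⟪r a, x⟫ ^ 4 / ‖r a‖ ^ 2 ∂(stdGaussian (Vec K)) :=
        integral_mono (integrable_norm_comb_pow_four v)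
          ((integrable_finsetSum _ fun a _ => hI a).const_mul _) hpt
    _ = sqSize v * ∑ a, 3 * ‖r a‖ ^ 2 := by
        rw [integral_const_mul, integral_finsetSum _ fun a _ => hI a]
        congr 1
        refine Finset.sum_congr rfl fun a _ => ?_
        rw [integral_div, integral_inner_pow_four_stdGaussian]
        by_cases h0 : r a = 0
        · simp [h0]
        · have : ‖r a‖ ≠ 0 := by simpa using h0
          field_simp
    _ = _ := by rw [← Finset.mul_sum, sum_norm_toLp_apply_sq]; ring

theorem map_neg_stdGaussian (K : ℕ) :
    (stdGaussian (Vec K)).map (fun x => -x) = stdGaussian (Vec K) :=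
  stdGaussian_map (LinearIsometryEquiv.neg ℝ (E := Vec K))

/-- The integrand is odd and the Gaussian law is symmetric. -/
theorem integral_inner_comb_mul_norm_sq (f : Vec n) :
    ∫ x, ⟪f, comb v x⟫ * ‖comb v x‖ ^ 2 ∂(stdGaussian (Vec K)) = 0 := by
  have h : ∫ x, ⟪f, comb v x⟫ * ‖comb v x‖ ^ 2 ∂(stdGaussian (Vec K))
      = ∫ x, -(⟪f, comb v x⟫ * ‖comb v x‖ ^ 2) ∂(stdGaussian (Vec K)) := by
    conv_lhs => rw [← map_neg_stdGaussian]
    rw [integral_map (by fun_prop) (by fun_prop)]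
    simp [comb_neg]
  rw [integral_neg] at h
  linarith

/-- The square loss at a Gaussian perturbation, corrected for the noise, is unbiased. -/
theorem integral_norm_add_comb_sq (f : Vec n) :
    ∫ x, (‖f + comb v x‖ ^ 2 - sqSize v) ∂(stdGaussian (Vec K)) = ‖f‖ ^ 2 := by
  have h : ∀ x, ‖f + comb v x‖ ^ 2 - sqSize v
      = 2 * ⟪f, comb v x⟫ + ‖comb v x‖ ^ 2 + (‖f‖ ^ 2 - sqSize v) := by
    intro x
    rw [norm_add_sq_real]; ring
  have i1 := (integrable_inner_comb v f).const_mul 2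
  have i2 := integrable_norm_comb_sq v
  simp_rw [h]
  rw [integral_add (by exact i1.add i2) (integrable_const _), integral_add i1 i2,
    integral_const_mul, integral_inner_comb, integral_norm_comb_sq]
  simp

/-- After expansion the odd terms integrate to 0. With a = ‖f‖² and τ = `sqSize v` the rest is at
most (a - 1/2)² + 4aτ + 2τ², which on a ≤ 1, τ ≤ 1/2 is largest at a = 1, τ = 1/2, with value 11/4.
Recentring the loss by 1/2 keeps the first term at most 1/4. -/
theorem integral_norm_add_comb_sq_sub_sq_le {f : Vec n} (hf : ‖f‖ ≤ 1) (hv : sqSize v ≤ 1 / 2) :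
    ∫ x, (‖f + comb v x‖ ^ 2 - sqSize v - 1 / 2) ^ 2 ∂(stdGaussian (Vec K)) ≤ 11 / 4 := by
  set A : ℝ := ‖f‖ ^ 2 - 1 / 2 - sqSize v with hA
  have h : ∀ x, (‖f + comb v x‖ ^ 2 - sqSize v - 1 / 2) ^ 2
      = A ^ 2 + 4 * ⟪f, comb v x⟫ ^ 2 + ‖comb v x‖ ^ 4 + (4 * A) * ⟪f, comb v x⟫
        + (2 * A) * ‖comb v x‖ ^ 2 + 4 * (⟪f, comb v x⟫ * ‖comb v x‖ ^ 2) := by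
    intro x
    rw [norm_add_sq_real]; ring
  have i1 := (integrable_inner_comb_sq v f).const_mul 4
  have i2 := integrable_norm_comb_pow_four v
  have i3 := (integrable_inner_comb v f).const_mul (4 * A)
  have i4 := (integrable_norm_comb_sq v).const_mul (2 * A)
  have i5 := (integrable_inner_comb_mul_norm_sq v f).const_mul 4
  have i0 : Integrable (fun _ : Vec K => A ^ 2) (stdGaussian (Vec K)) := integrable_const _
  simp_rw [h]
  rw [integral_add (by exact (((i0.add i1).add i2).add i3).add i4) i5,
    integral_add (by exact ((i0.add i1).add i2).add i3) i4,
    integral_add (by exact (i0.add i1).add i2) i3, integral_add (by exact i0.add i1) i2,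
    integral_add i0 i1]
  simp only [integral_const_mul, integral_inner_comb, integral_norm_comb_sq,
    integral_inner_comb_mul_norm_sq, integral_const, probReal_univ, one_smul]
  have h2 := integral_inner_comb_sq_le v f
  have h4 := integral_norm_comb_pow_four_le v
  have h0 := sqSize_nonneg v
  have hf1 : ‖f‖ ^ 2 ≤ 1 := by nlinarith [norm_nonneg f]
  have hf0 : 0 ≤ ‖f‖ ^ 2 := sq_nonneg _
  have key : A ^ 2 + 4 * (‖f‖ ^ 2 * sqSize v) + 3 * sqSize v ^ 2 + 2 * A * sqSize v ≤ 11 / 4 := by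
    rw [hA]
    generalize ‖f‖ ^ 2 = a at *
    generalize sqSize v = τ at *
    nlinarith [mul_nonneg hf0 (sub_nonneg.2 hf1), mul_nonneg h0 (sub_nonneg.2 hv),
      mul_nonneg h0 (sub_nonneg.2 hf1)]
  linarith

end comb

/-! ### PAC-Bayes bound at a fixed temperature -/

theorem exp_le_one_add_add_sq {x : ℝ} (hx : x ≤ 1 / 2) :
    Real.exp x ≤ 1 + x + 3 / 5 * x ^ 2 := by
  -- The coefficient 3/5 is nearly sharp at x = 1/2. For negative x the reciprocal is bounded below
  -- by the quadratic Taylor polynomial of exp at -x.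
  rcases le_total 0 x with h0 | h0
  · have h := Real.exp_bound' h0 (hx.trans (by norm_num)) (n := 4) (by norm_num)
    simp [Finset.sum_range_succ, Nat.factorial] at h
    nlinarith [mul_nonneg h0 (sub_nonneg.2 hx), pow_nonneg h0 2, pow_nonneg h0 3,
      mul_nonneg (pow_nonneg h0 2) (sub_nonneg.2 hx), mul_nonneg (pow_nonneg h0 3) (sub_nonneg.2 hx)]
  · have h1 : 1 - x + x ^ 2 / 2 ≤ Real.exp (-x) := by
      have := Real.quadratic_le_exp_of_nonneg (neg_nonneg.2 h0)
      nlinarith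
    have h2 : Real.exp x * Real.exp (-x) = 1 := by rw [← Real.exp_add]; simp
    have h3 := Real.exp_pos x
    have h4 : Real.exp x * (1 - x + x ^ 2 / 2) ≤ 1 :=
      (mul_le_mul_of_nonneg_left h1 h3.le).trans h2.le
    have h5 : 1 ≤ (1 + x + 3 / 5 * x ^ 2) * (1 - x + x ^ 2 / 2) := by
      nlinarith [sq_nonneg x, pow_nonneg (neg_nonneg.2 h0) 3, sq_nonneg (x ^ 2)]
    have h6 : 0 < 1 - x + x ^ 2 / 2 := by nlinarith [sq_nonneg x]
    exact le_of_mul_le_mul_right (h4.trans h5) h6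

section PacBayes

set_option linter.unusedSectionVars false

variable {Z : Type*} [MeasurableSpace Z] {n K : ℕ}

/-- The noise-corrected square loss of the linear predictor `w`, recentred by `1 / 2`. -/
def centredLoss (X : Z → Fin K → Vec n) (y : Z → Vec n) (z : Z) (w : Vec K) : ℝ :=
  ‖comb (X z) w - y z‖ ^ 2 - sqSize (X z) - 1 / 2

variable {X : Z → Fin K → Vec n} {y : Z → Vec n}

theorem measurable_sqSize (hX : ∀ k, Measurable fun z => X z k) :
    Measurable fun z => sqSize (X z) := by
  unfold sqSize
  fun_prop

theorem measurable_comb_uncurry (hX : ∀ k, Measurable fun z => X z k) :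
    Measurable fun p : Z × Vec K => comb (X p.1) p.2 := by
  unfold comb
  fun_prop

theorem measurable_comb_left (hX : ∀ k, Measurable fun z => X z k) (w : Vec K) :
    Measurable fun z => comb (X z) w := by
  unfold comb
  fun_prop

theorem measurable_centredLoss (hX : ∀ k, Measurable fun z => X z k) (hy : Measurable y) :
    Measurable fun p : Z × Vec K => centredLoss X y p.1 p.2 := by
  have h1 := measurable_comb_uncurry hX
  have h2 := measurable_sqSize hX
  exact (((h1.sub (hy.comp measurable_fst)).norm.pow_const 2).sub
    (h2.comp measurable_fst)).sub_const _

theorem measurable_centredLoss_comp {A : Type*} [MeasurableSpace A]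
    (hX : ∀ k, Measurable fun z => X z k) (hy : Measurable y) {f : A → Z} {g : A → Vec K}
    (hf : Measurable f) (hg : Measurable g) : Measurable fun a => centredLoss X y (f a) (g a) := by
  have h := (measurable_centredLoss hX hy).comp (hf.prodMk hg)
  exact h

theorem measurable_centredLoss_left (hX : ∀ k, Measurable fun z => X z k) (hy : Measurable y)
    (w : Vec K) : Measurable fun z => centredLoss X y z w :=
  measurable_centredLoss_comp hX hy measurable_id measurable_const

/-- The noise correction and the recentring each subtract at most 1/2. No upper bound uniform in `w`
exists in general, but none is needed, since only negative multiples are exponentiated: for 0 ≤ l ≤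
1/2 the exponent is at most 1/2, the range of `exp_le_one_add_add_sq`. -/
theorem neg_one_le_centredLoss (hs : ∀ z, sqSize (X z) ≤ 1 / 2) (z : Z) (w : Vec K) :
    -1 ≤ centredLoss X y z w := by
  have := hs z
  have := sq_nonneg ‖comb (X z) w - y z‖
  unfold centredLoss
  linarith

theorem abs_centredLoss_le (hs : ∀ z, sqSize (X z) ≤ 1 / 2) {Y : ℝ} (hY : ∀ z, ‖y z‖ ≤ Y)
    (z : Z) (w : Vec K) : |centredLoss X y z w| ≤ ‖w‖ ^ 2 + (2 * Y ^ 2 + 1) := by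
  have h1 := norm_comb_sq_le (X z) w
  have h2 : sqSize (X z) * ‖w‖ ^ 2 ≤ 1 / 2 * ‖w‖ ^ 2 := by gcongr; exact hs z
  have h3 : ‖y z‖ ^ 2 ≤ Y ^ 2 := by gcongr; exact hY z
  have h4 : ‖comb (X z) w - y z‖ ^ 2 ≤ 2 * ‖comb (X z) w‖ ^ 2 + 2 * ‖y z‖ ^ 2 := by
    have h5 := parallelogram_law_with_norm ℝ (comb (X z) w) (y z)
    nlinarith [sq_nonneg ‖comb (X z) w + y z‖]
  have h6 := sqSize_nonneg (X z)
  have h7 := hs z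
  rw [abs_le]
  constructor
  · have := neg_one_le_centredLoss (y := y) hs z w
    nlinarith [sq_nonneg ‖w‖, sq_nonneg Y]
  · unfold centredLoss
    linarith

variable (D : Measure Z) [IsProbabilityMeasure D]

theorem integrable_centredLoss (hX : ∀ k, Measurable fun z => X z k) (hy : Measurable y)
    (hs : ∀ z, sqSize (X z) ≤ 1 / 2) {Y : ℝ} (hY : ∀ z, ‖y z‖ ≤ Y) (w : Vec K) :
    Integrable (fun z => centredLoss X y z w) D :=
  Integrable.of_bound (measurable_centredLoss_left hX hy w).aestronglyMeasurable
    (‖w‖ ^ 2 + (2 * Y ^ 2 + 1)) (Eventually.of_forall fun z => abs_centredLoss_le hs hY z w)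

theorem integrable_centredLoss_sq (hX : ∀ k, Measurable fun z => X z k) (hy : Measurable y)
    (hs : ∀ z, sqSize (X z) ≤ 1 / 2) {Y : ℝ} (hY : ∀ z, ‖y z‖ ≤ Y) (w : Vec K) :
    Integrable (fun z => centredLoss X y z w ^ 2) D := by
  refine Integrable.of_bound ((measurable_centredLoss_left hX hy w).pow_const 2).aestronglyMeasurable
    ((‖w‖ ^ 2 + (2 * Y ^ 2 + 1)) ^ 2) (Eventually.of_forall fun z => ?_)
  rw [norm_pow]
  gcongr
  exact abs_centredLoss_le hs hY z w

theorem integrable_exp_centredLoss (hX : ∀ k, Measurable fun z => X z k) (hy : Measurable y)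
    (hs : ∀ z, sqSize (X z) ≤ 1 / 2) {l : ℝ} (hl : 0 ≤ l) (w : Vec K) :
    Integrable (fun z => Real.exp (-l * centredLoss X y z w)) D := by
  refine Integrable.of_bound (((measurable_centredLoss_left hX hy w).const_mul (-l)).exp).aestronglyMeasurable
    (Real.exp l) (Eventually.of_forall fun z => ?_)
  rw [Real.norm_eq_abs, Real.abs_exp]
  gcongr
  nlinarith [neg_one_le_centredLoss (y := y) hs z w]

theorem integral_exp_centredLoss_le (hX : ∀ k, Measurable fun z => X z k) (hy : Measurable y)
    (hs : ∀ z, sqSize (X z) ≤ 1 / 2) {Y : ℝ} (hY : ∀ z, ‖y z‖ ≤ Y) {l : ℝ} (hl : 0 ≤ l)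
    (hl' : l ≤ 1 / 2) (w : Vec K) :
    ∫ z, Real.exp (-l * centredLoss X y z w) ∂D ≤
      Real.exp (-l * ∫ z, centredLoss X y z w ∂D +
        3 / 5 * l ^ 2 * ∫ z, centredLoss X y z w ^ 2 ∂D) := by
  have i1 := (integrable_centredLoss D hX hy hs hY w).const_mul (-l)
  have i2 := (integrable_centredLoss_sq D hX hy hs hY w).const_mul (3 / 5 * l ^ 2)
  have i0 : Integrable (fun _ : Z => (1 : ℝ)) D := integrable_const _
  calc ∫ z, Real.exp (-l * centredLoss X y z w) ∂D
      ≤ ∫ z, (1 + -l * centredLoss X y z w + 3 / 5 * l ^ 2 * centredLoss X y z w ^ 2) ∂D := by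
        refine integral_mono (integrable_exp_centredLoss D hX hy hs hl w) ((i0.add i1).add i2)
          fun z => ?_
        refine (exp_le_one_add_add_sq ?_).trans (le_of_eq (by ring))
        nlinarith [neg_one_le_centredLoss (y := y) hs z w]
    _ = (-l * ∫ z, centredLoss X y z w ∂D +
        3 / 5 * l ^ 2 * ∫ z, centredLoss X y z w ^ 2 ∂D) + 1 := by
        rw [integral_add (by exact i0.add i1) i2, integral_add i0 i1, integral_const_mul,
          integral_const_mul]
        simp
        ring
    _ ≤ _ := Real.add_one_le_exp _

/-- The exponent of the PAC-Bayes argument. -/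
def pacExponent {M : ℕ} (X : Z → Fin K → Vec n) (y : Z → Vec n) (D : Measure Z) (l : ℝ)
    (s : Fin M → Z) (w : Vec K) : ℝ :=
  ∑ i, (-l * centredLoss X y (s i) w) + M * (l * ∫ z, centredLoss X y z w ∂D -
    3 / 5 * l ^ 2 * ∫ z, centredLoss X y z w ^ 2 ∂D)

theorem measurable_pacExponent {M : ℕ} (hX : ∀ k, Measurable fun z => X z k) (hy : Measurable y)
    (l : ℝ) : Measurable fun p : (Fin M → Z) × Vec K => pacExponent X y D l p.1 p.2 := by
  have h0 := measurable_centredLoss hX hy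
  have hs : Measurable fun p : Vec K × Z => centredLoss X y p.2 p.1 :=
    measurable_centredLoss_comp hX hy measurable_snd measurable_fst
  have h1 : Measurable fun w : Vec K => ∫ z, centredLoss X y z w ∂D :=
    (hs.stronglyMeasurable.integral_prod_right (ν := D)).measurable
  have h2 : Measurable fun w : Vec K => ∫ z, centredLoss X y z w ^ 2 ∂D :=
    ((hs.pow_const 2).stronglyMeasurable.integral_prod_right (ν := D)).measurable
  have h3 : ∀ i : Fin M, Measurable fun p : (Fin M → Z) × Vec K => centredLoss X y (p.1 i) p.2 :=
    fun i => measurable_centredLoss_comp hX hy ((measurable_pi_apply i).comp measurable_fst)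
      measurable_snd
  have h4 := h1.comp (measurable_snd : Measurable (Prod.snd : (Fin M → Z) × Vec K → Vec K))
  have h5 := h2.comp (measurable_snd : Measurable (Prod.snd : (Fin M → Z) × Vec K → Vec K))
  simp only [Function.comp_def] at h4 h5
  exact (Finset.measurable_sum _ fun i _ => (h3 i).const_mul _).add
    (((h4.const_mul l).sub (h5.const_mul (3 / 5 * l ^ 2))).const_mul _)

/-- Independence factors the exponential moment over the sample, and the deterministic part of the
exponent cancels the one-point bound `integral_exp_centredLoss_le` in each factor. -/
theorem lintegral_exp_pacExponent_le {M : ℕ} (hX : ∀ k, Measurable fun z => X z k)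
    (hy : Measurable y) (hs : ∀ z, sqSize (X z) ≤ 1 / 2) {Y : ℝ} (hY : ∀ z, ‖y z‖ ≤ Y) {l : ℝ}
    (hl : 0 ≤ l) (hl' : l ≤ 1 / 2) (w : Vec K) :
    ∫⁻ s, ENNReal.ofReal (Real.exp (pacExponent X y D l s w)) ∂(Measure.pi fun _ : Fin M => D)
      ≤ 1 := by
  set c : ℝ := l * ∫ z, centredLoss X y z w ∂D - 3 / 5 * l ^ 2 * ∫ z, centredLoss X y z w ^ 2 ∂D
    with hc
  have h1 : ∀ s : Fin M → Z, Real.exp (pacExponent X y D l s w)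
      = Real.exp (M * c) * ∏ i, Real.exp (-l * centredLoss X y (s i) w) := by
    intro s
    rw [pacExponent, ← hc, add_comm, Real.exp_add, Real.exp_sum]
  have hI : Integrable (fun s : Fin M → Z => Real.exp (pacExponent X y D l s w))
      (Measure.pi fun _ : Fin M => D) := by
    simp_rw [h1]
    exact (Integrable.fintype_prod fun _ => integrable_exp_centredLoss D hX hy hs hl w).const_mul _
  rw [← ofReal_integral_eq_lintegral_ofReal hI (Eventually.of_forall fun _ => (Real.exp_pos _).le),
    ENNReal.ofReal_le_one]
  simp_rw [h1]
  rw [integral_const_mul, integral_fintype_prod_eq_prod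
    (f := fun (_ : Fin M) z => Real.exp (-l * centredLoss X y z w)), Finset.prod_const,
    Finset.card_univ, Fintype.card_fin]
  have h2 : ∫ z, Real.exp (-l * centredLoss X y z w) ∂D ≤ Real.exp (-c) := by
    refine (integral_exp_centredLoss_le D hX hy hs hY hl hl' w).trans (le_of_eq ?_)
    rw [hc]; ring_nf
  calc _ ≤ Real.exp (M * c) * Real.exp (-c) ^ M := by
        gcongr
    _ = 1 := by rw [← Real.exp_nat_mul, ← Real.exp_add]; simp

/-- Averaging over the posterior turns the corrected losses into the noiseless losses of `h`, and
the recentring by 1/2 cancels between population and sample. The second moment costs 33/20 =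
(3/5)·(11/4) per sample point. Admissibility enters only under `D`, so the sample itself may be
arbitrary. -/
theorem integral_pacExponent_add_ge {M : ℕ} (hX : ∀ k, Measurable fun z => X z k)
    (hy : Measurable y) (hs : ∀ z, sqSize (X z) ≤ 1 / 2) {Y : ℝ} (hY : ∀ z, ‖y z‖ ≤ Y) (l : ℝ)
    (s : Fin M → Z) {h : Vec K} (hh : ∀ᵐ z ∂D, ‖comb (X z) h - y z‖ ≤ 1) :
    Integrable (fun x => pacExponent X y D l s (h + x)) (stdGaussian (Vec K)) ∧
    l * ∑ i, (∫ z, ‖comb (X z) h - y z‖ ^ 2 ∂D - ‖comb (X (s i)) h - y (s i)‖ ^ 2)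
      - 33 / 20 * M * l ^ 2 ≤
        ∫ x, pacExponent X y D l s (h + x) ∂(stdGaussian (Vec K)) := by
  set γ := stdGaussian (Vec K) with hγ
  set b : ℝ := 2 * Y ^ 2 + 1 with hb
  have hb0 : 0 ≤ b := by positivity
  have hm : Measurable fun p : Vec K × Z => centredLoss X y p.2 (h + p.1) :=
    measurable_centredLoss_comp hX hy measurable_snd (measurable_fst.const_add h)
  -- Quadratic growth in the noise, uniform in `z`. With Gaussian moments it justifies every
  -- exchange of integrals below.
  have habs : ∀ z x, |centredLoss X y z (h + x)| ≤ (2 * ‖h‖ ^ 2 + b + 2) * (1 + ‖x‖ ^ 2) := by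
    intro z x
    refine (abs_centredLoss_le hs hY z _).trans ?_
    have : ‖h + x‖ ^ 2 ≤ 2 * ‖h‖ ^ 2 + 2 * ‖x‖ ^ 2 := by
      have h5 := parallelogram_law_with_norm ℝ h x
      nlinarith [sq_nonneg ‖h - x‖]
    nlinarith [mul_nonneg (by positivity : 0 ≤ 2 * ‖h‖ ^ 2 + b) (sq_nonneg ‖x‖)]
  set C : ℝ := 2 * ‖h‖ ^ 2 + b + 2 with hC
  have hC0 : 0 ≤ C := by positivity
  have habs1 : ∀ z x, |centredLoss X y z (h + x)| ≤ (2 * C) * (1 + ‖x‖ ^ 4) := by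
    intro z x
    have h1 := sq_le_one_add_pow_four ‖x‖
    calc _ ≤ C * (1 + ‖x‖ ^ 2) := habs z x
      _ ≤ C * (2 * (1 + ‖x‖ ^ 4)) := by gcongr; nlinarith [pow_nonneg (norm_nonneg x) 4]
      _ = _ := by ring
  have habs2 : ∀ z x, |centredLoss X y z (h + x) ^ 2| ≤ (2 * C ^ 2) * (1 + ‖x‖ ^ 4) := by
    intro z x
    rw [abs_pow]
    calc _ ≤ (C * (1 + ‖x‖ ^ 2)) ^ 2 := by gcongr; exact habs z x
      _ = C ^ 2 * (1 + ‖x‖ ^ 2) ^ 2 := by ring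
      _ ≤ C ^ 2 * (2 * (1 + ‖x‖ ^ 4)) := by gcongr; nlinarith [sq_nonneg (‖x‖ ^ 2 - 1)]
      _ = _ := by ring
  have hpoly : Integrable (fun x : Vec K => 1 + ‖x‖ ^ 4) γ :=
    integrable_of_bound_pow_four (by fun_prop) 1 fun x => by
      rw [abs_of_nonneg (by positivity), one_mul]
  have iP1 : Integrable (fun p : Vec K × Z => centredLoss X y p.2 (h + p.1)) (γ.prod D) :=
    Integrable.mono' ((hpoly.const_mul (2 * C)).comp_fst D) hm.aestronglyMeasurable
      (Eventually.of_forall fun p => habs1 p.2 p.1)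
  have iP2 : Integrable (fun p : Vec K × Z => centredLoss X y p.2 (h + p.1) ^ 2) (γ.prod D) :=
    Integrable.mono' ((hpoly.const_mul (2 * C ^ 2)).comp_fst D)
      (hm.pow_const 2).aestronglyMeasurable (Eventually.of_forall fun p => habs2 p.2 p.1)
  have iz : ∀ z, Integrable (fun x => centredLoss X y z (h + x)) γ := fun z =>
    integrable_of_bound_pow_four
      (measurable_centredLoss_comp hX hy measurable_const
        (measurable_id.const_add h)).aestronglyMeasurable _ (habs1 z)
  have ez : ∀ z x, centredLoss X y z (h + x)
      = ‖(comb (X z) h - y z) + comb (X z) x‖ ^ 2 - sqSize (X z) - 1 / 2 := by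
    intro z x
    rw [centredLoss, comb_add]
    congr 4
    abel
  have m1 : ∀ z, ∫ x, centredLoss X y z (h + x) ∂γ = ‖comb (X z) h - y z‖ ^ 2 - 1 / 2 := by
    intro z
    have i := (iz z).add (integrable_const (1 / 2 : ℝ))
    simp_rw [ez]
    rw [integral_sub _ (integrable_const _), integral_norm_add_comb_sq]
    · simp
    · refine i.congr (Eventually.of_forall fun x => ?_)
      simp [ez]
  have m2 : ∀ᵐ z ∂D, ∫ x, centredLoss X y z (h + x) ^ 2 ∂γ ≤ 11 / 4 := by
    filter_upwards [hh] with z hz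
    simp_rw [ez]
    exact integral_norm_add_comb_sq_sub_sq_le _ hz (hs z)
  have jI : Integrable (fun z => ‖comb (X z) h - y z‖ ^ 2) D := by
    refine Integrable.of_bound (C := 1)
      (((measurable_comb_left hX h).sub hy).norm.pow_const 2).aestronglyMeasurable ?_
    filter_upwards [hh] with z hz
    rw [norm_pow, norm_norm]
    exact pow_le_one₀ (norm_nonneg _) hz
  have s1 : ∫ x, ∫ z, centredLoss X y z (h + x) ∂D ∂γ
      = ∫ z, ‖comb (X z) h - y z‖ ^ 2 ∂D - 1 / 2 := by
    rw [integral_integral_swap (f := fun x z => centredLoss X y z (h + x)) iP1]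
    simp_rw [m1]
    rw [integral_sub jI (integrable_const _)]
    simp
  have s2 : ∫ x, ∫ z, centredLoss X y z (h + x) ^ 2 ∂D ∂γ ≤ 11 / 4 := by
    rw [integral_integral_swap (f := fun x z => centredLoss X y z (h + x) ^ 2) iP2]
    calc _ ≤ ∫ _ : Z, (11 / 4 : ℝ) ∂D :=
          integral_mono_ae (iP2.integral_prod_right) (integrable_const _) m2
      _ = _ := by simp
  have k1 : Integrable (fun x => ∑ i, (-l * centredLoss X y (s i) (h + x))) γ :=
    integrable_finsetSum _ fun i _ => (iz (s i)).const_mul _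
  have k2 : Integrable (fun x => l * ∫ z, centredLoss X y z (h + x) ∂D) γ :=
    iP1.integral_prod_left.const_mul _
  have k3 : Integrable (fun x => 3 / 5 * l ^ 2 * ∫ z, centredLoss X y z (h + x) ^ 2 ∂D) γ :=
    iP2.integral_prod_left.const_mul _
  have k4 : Integrable (fun x => (M : ℝ) * (l * ∫ z, centredLoss X y z (h + x) ∂D -
      3 / 5 * l ^ 2 * ∫ z, centredLoss X y z (h + x) ^ 2 ∂D)) γ := (k2.sub k3).const_mul _
  refine ⟨k1.add k4, ?_⟩
  have e : ∫ x, pacExponent X y D l s (h + x) ∂γ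
      = ∑ i, (-l * (‖comb (X (s i)) h - y (s i)‖ ^ 2 - 1 / 2))
        + M * (l * (∫ z, ‖comb (X z) h - y z‖ ^ 2 ∂D - 1 / 2)
          - 3 / 5 * l ^ 2 * ∫ x, ∫ z, centredLoss X y z (h + x) ^ 2 ∂D ∂γ) := by
    unfold pacExponent
    rw [integral_add k1 k4, integral_finsetSum _ fun i _ => (iz (s i)).const_mul _,
      integral_const_mul, integral_sub k2 k3, integral_const_mul, integral_const_mul, s1]
    simp_rw [integral_const_mul, m1]
  rw [e]
  have hM : (0 : ℝ) ≤ M := Nat.cast_nonneg M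
  have : (M : ℝ) * (3 / 5 * l ^ 2 * ∫ x, ∫ z, centredLoss X y z (h + x) ^ 2 ∂D ∂γ)
      ≤ M * (3 / 5 * l ^ 2 * (11 / 4)) := by gcongr
  rw [Finset.sum_sub_distrib, ← Finset.mul_sum, Finset.sum_sub_distrib]
  simp only [Finset.sum_const, Finset.card_univ, Fintype.card_fin, nsmul_eq_mul]
  linarith

/-- PAC-Bayes bound at a fixed temperature `l` for the linear predictors whose loss is
at most `1` almost surely. -/
theorem measure_pacBayes_le {M : ℕ} (hX : ∀ k, Measurable fun z => X z k)
    (hy : Measurable y) (hs : ∀ z, sqSize (X z) ≤ 1 / 2) {Y : ℝ} (hY : ∀ z, ‖y z‖ ≤ Y) {l : ℝ}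
    (hl : 0 ≤ l) (hl' : l ≤ 1 / 2) {δ : ℝ} (hδ : 0 < δ) :
    (Measure.pi fun _ : Fin M => D) {s | ∃ h : Vec K, (∀ᵐ z ∂D, ‖comb (X z) h - y z‖ ≤ 1) ∧
      ‖h‖ ^ 2 / 2 + Real.log (1 / δ) + 33 / 20 * M * l ^ 2 <
        l * ∑ i, (∫ z, ‖comb (X z) h - y z‖ ^ 2 ∂D - ‖comb (X (s i)) h - y (s i)‖ ^ 2)}
      ≤ ENNReal.ofReal δ := by
  set P : Measure (Fin M → Z) := Measure.pi fun _ : Fin M => D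
  set γ := stdGaussian (Vec K)
  have hm := measurable_pacExponent (M := M) D hX hy l
  have hm' : Measurable fun p : (Fin M → Z) × Vec K =>
      ENNReal.ofReal (Real.exp (pacExponent X y D l p.1 p.2)) := hm.exp.ennreal_ofReal
  have hmR : Measurable fun s : Fin M → Z =>
      ∫⁻ w, ENNReal.ofReal (Real.exp (pacExponent X y D l s w)) ∂γ := hm'.lintegral_prod_right'
  have htot : ∫⁻ s, ∫⁻ w, ENNReal.ofReal (Real.exp (pacExponent X y D l s w)) ∂γ ∂P ≤ 1 := by
    rw [lintegral_lintegral_swap hm'.aemeasurable]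
    calc _ ≤ ∫⁻ _ : Vec K, 1 ∂γ :=
          lintegral_mono fun w => lintegral_exp_pacExponent_le D hX hy hs hY hl hl' w
      _ = 1 := by simp
  -- Markov's inequality for the prior average of the exponential. The resulting event does not
  -- mention `h`, which makes the bound uniform in `h`.
  have hmarkov := meas_ge_le_lintegral_div (μ := P) hmR.aemeasurable
    (ε := ENNReal.ofReal (1 / δ)) (by simpa using hδ) ENNReal.ofReal_ne_top
  refine (measure_mono ?_).trans (hmarkov.trans ?_)
  · rintro s ⟨h, hh, hlt⟩
    obtain ⟨hI, hge⟩ := integral_pacExponent_add_ge D hX hy hs hY l s hh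
    have hp : Measurable fun w : Vec K => (s, w) := measurable_prodMk_left
    have hms : Measurable fun w : Vec K => pacExponent X y D l s w := by
      have h1 := hm.comp hp
      exact h1
    have hj := ofReal_exp_integral_add_le h
      (F := fun w => pacExponent X y D l s w)
      hms hI
    refine le_trans (ENNReal.ofReal_le_ofReal ?_) hj
    rw [← Real.exp_log (by positivity : 0 < 1 / δ)]
    gcongr
    linarith
  · calc _ ≤ 1 / ENNReal.ofReal (1 / δ) := by gcongr
      _ = ENNReal.ofReal δ := by
        rw [one_div, ← ENNReal.ofReal_inv_of_pos (by positivity)]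
        simp

end PacBayes

/-! ### Choice of the temperature -/

theorem succ_le_sqrt_two_pow (j : ℕ) : (j + 1 : ℝ) ≤ 3 / 2 * √(2 ^ j) := by
  have h : ∀ j : ℕ, ((j : ℝ) + 1) ^ 2 ≤ 9 / 4 * 2 ^ j := by
    intro j
    rcases Nat.lt_or_ge j 2 with hj | hj
    · interval_cases j <;> norm_num
    · induction j, hj using Nat.le_induction with
      | base => norm_num
      | succ k hk ih =>
        have : (2 : ℝ) ≤ k := by exact_mod_cast hk
        have h2 : (2 : ℝ) ^ (k + 1) = 2 * 2 ^ k := pow_succ' _ _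
        rw [h2]
        push_cast
        nlinarith
  have h1 : (3 / 2 * √(2 ^ j : ℝ)) ^ 2 = 9 / 4 * 2 ^ j := by
    rw [mul_pow, Real.sq_sqrt (by positivity)]; norm_num
  exact le_of_sq_le_sq (by rw [h1]; exact h j) (by positivity)

/-- The temperature used at the `j`-th scale. -/
def scaleTemp (M L : ℝ) (j : ℕ) : ℝ := √((2 ^ j + L) / (33 / 20 * M))

/-- For known G the optimal temperature balances G + L against (33/20)Ml². Here G is replaced by the
least 2ʲ above it, at most twice too large unless j = 0, and the union-bound cost (j + 1) log 2 is
absorbed because it is O(2^(j/2)). The hypothesis `hGL` keeps the temperature below 1/2. -/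
theorem exists_scale {G L ℓ M : ℝ} (hG : 0 ≤ G) (hL : 1.38 ≤ L) (hℓ : ℓ ≤ L) (hM : 0 < M)
    (hGL : 2 * G + 2 * L ≤ 33 / 80 * M) :
    ∃ j : ℕ, scaleTemp M L j ≤ 1 / 2 ∧ 0 < scaleTemp M L j ∧
      G + ℓ + (j + 1) * Real.log 2 + 33 / 20 * M * scaleTemp M L j ^ 2 ≤
        scaleTemp M L j * (√M * (2.75 * √G + 4.5 * √L)) := by
  have hex : ∃ j : ℕ, G ≤ 2 ^ j := by
    obtain ⟨j, hj⟩ := pow_unbounded_of_one_lt G (one_lt_two : (1 : ℝ) < 2)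
    exact ⟨j, hj.le⟩
  classical
  set j := Nat.find hex with hj
  have hjG : G ≤ 2 ^ j := Nat.find_spec hex
  have hlow : j = 0 ∨ (2 : ℝ) ^ j ≤ 2 * G := by
    rcases Nat.eq_zero_or_pos j with h0 | h0
    · exact Or.inl h0
    · right
      have h1 := Nat.find_min hex (m := j - 1) (by omega)
      have h2 : (2 : ℝ) ^ j = 2 * 2 ^ (j - 1) := by
        rw [← pow_succ']; congr 1; omega
      rw [h2]
      linarith
  have hlog : Real.log 2 ≤ 0.6932 := by linarith [Real.log_two_lt_d9]
  have hlog0 : 0 ≤ Real.log 2 := Real.log_nonneg (by norm_num)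
  set N : ℝ := 2 ^ j with hN
  have hN1 : 1 ≤ N := one_le_pow₀ (by norm_num)
  have hQ0 : 0 < N + L := by linarith
  have hsq : scaleTemp M L j ^ 2 = (N + L) / (33 / 20 * M) := Real.sq_sqrt (by positivity)
  have hpos : 0 < scaleTemp M L j := Real.sqrt_pos.2 (by positivity)
  have hvM : 33 / 20 * M * scaleTemp M L j ^ 2 = N + L := by
    rw [hsq]; field_simp
  refine ⟨j, ?_, hpos, ?_⟩
  · refine le_of_sq_le_sq ?_ (by norm_num)
    rw [hsq, div_le_iff₀ (by positivity)]
    rcases hlow with h0 | h0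
    · have : N = 1 := by rw [hN, h0]; norm_num
      linarith
    · linarith
  · rw [hvM]
    have hv : √(33 / 20 : ℝ) ≤ 1.2846 := by
      rw [Real.sqrt_le_left (by norm_num)]; norm_num
    have hv0 : 0 < √(33 / 20 : ℝ) := by positivity
    have hl : scaleTemp M L j * √M = √(N + L) / √(33 / 20) := by
      rw [scaleTemp, ← Real.sqrt_mul (by positivity), ← Real.sqrt_div (by positivity)]
      congr 1
      field_simp
      rfl
    rw [← mul_assoc, hl, div_mul_eq_mul_div, le_div_iff₀ hv0]
    set g := √G
    set q := √(N + L)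
    set a := √L
    set m := √N
    have hg : g ^ 2 = G := Real.sq_sqrt hG
    have ha : a ^ 2 = L := Real.sq_sqrt (by linarith)
    have hm : m ^ 2 = N := Real.sq_sqrt (by linarith)
    have hg0 : 0 ≤ g := Real.sqrt_nonneg _
    have hm0 : 0 ≤ m := Real.sqrt_nonneg _
    have ha0 : 0 ≤ a := Real.sqrt_nonneg _
    have hq0 : 0 ≤ q := Real.sqrt_nonneg _
    have hqm : m ≤ q := Real.sqrt_le_sqrt (by linarith)
    have hqa : a ≤ q := Real.sqrt_le_sqrt (by linarith)
    have ha1 : 1.17 ≤ a := Real.le_sqrt_of_sq_le (by linarith)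
    have hjm : (j + 1 : ℝ) ≤ 3 / 2 * m := succ_le_sqrt_two_pow j
    rcases hlow with h0 | h0
    -- At the lowest scale G may be far below 2ʲ = 1. All the constants are then absorbed into the
    -- term 4.5√L, using L ≥ 1.38.
    · have hN' : N = 1 := by rw [hN, h0]; norm_num
      have hqaL : L + 0.43 ≤ q * a := by
        rw [← Real.sqrt_mul hQ0.le]
        refine Real.le_sqrt_of_sq_le ?_
        rw [hN']
        nlinarith
      have hG1 : G ≤ 1 := by rw [← hN']; exact hjG
      have hj0 : (j : ℝ) = 0 := by rw [h0]; simp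
      rw [hj0]
      have h1 : (G + ℓ + (0 + 1) * Real.log 2 + (N + L)) * √(33 / 20)
          ≤ (2.6932 + 2 * L) * 1.2846 := by
        refine mul_le_mul ?_ hv hv0.le (by linarith)
        linarith
      nlinarith [mul_nonneg hq0 hg0]
    · have hgm : g ≤ m := Real.sqrt_le_sqrt hjG
      have hmg : m ^ 2 ≤ 2 * g ^ 2 := by rw [hm, hg]; exact h0
      -- For m/g between 1 and √2 the ratio (g² + m²)/(mg) is at most 3/√2, and 1.2846 · 3/√2 <
      -- 2.75. This is the source of the constant 2.75.
      have k1 : (G + N) * 1.2846 ≤ 2.75 * (m * g) := by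
        have hmg' : m ≤ 1.41422 * g := by
          refine le_of_sq_le_sq ?_ (by positivity)
          nlinarith [sq_nonneg g]
        rw [← hg, ← hm]
        nlinarith [mul_nonneg (sub_nonneg.2 hgm) (sub_nonneg.2 hmg'), mul_nonneg hg0 hm0]
      have k2 : (2 * L + (j + 1) * Real.log 2) * 1.2846 ≤ 4.5 * (q * a) := by
        have h2 : (j + 1) * Real.log 2 ≤ 3 / 2 * m * 0.6932 := by gcongr
        have h3 : m * 1.17 ≤ q * a := by gcongr
        have h4 : L ≤ q * a := by rw [← ha, sq]; gcongr
        nlinarith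
      have k3 : m * g ≤ q * g := by gcongr
      have h1 : (G + ℓ + (j + 1) * Real.log 2 + (N + L)) * √(33 / 20)
          ≤ (G + N + (2 * L + (j + 1) * Real.log 2)) * 1.2846 := by
        refine mul_le_mul ?_ hv hv0.le (by positivity)
        linarith
      have h5 : q * (2.75 * g + 4.5 * a) = 2.75 * (q * g) + 4.5 * (q * a) := by ring
      rw [h5]
      linarith

/-! ### Union over the scales, and quantiles -/

section Uniform

variable {Z : Type*} [MeasurableSpace Z] {n K : ℕ} {X : Z → Fin K → Vec n} {y : Z → Vec n}
  (D : Measure Z) [IsProbabilityMeasure D]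

/-- PAC-Bayes bound, uniform over all scales. -/
theorem measure_pacBayes_scales_le {M : ℕ} (hX : ∀ k, Measurable fun z => X z k)
    (hy : Measurable y) (hs : ∀ z, sqSize (X z) ≤ 1 / 2) {Y : ℝ} (hY : ∀ z, ‖y z‖ ≤ Y)
    (L : ℝ) {δ : ℝ} (hδ : 0 < δ) :
    (Measure.pi fun _ : Fin M => D) {s | ∃ j : ℕ, scaleTemp M L j ≤ 1 / 2 ∧
      ∃ h : Vec K, (∀ᵐ z ∂D, ‖comb (X z) h - y z‖ ≤ 1) ∧
      ‖h‖ ^ 2 / 2 + Real.log (1 / δ) + (j + 1) * Real.log 2 + 33 / 20 * M * scaleTemp M L j ^ 2 <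
        scaleTemp M L j *
          ∑ i, (∫ z, ‖comb (X z) h - y z‖ ^ 2 ∂D - ‖comb (X (s i)) h - y (s i)‖ ^ 2)}
      ≤ ENNReal.ofReal δ := by
  rw [Set.ofPred_exists]
  refine (measure_iUnion_le _).trans ?_
  -- Scale j receives probability δ/2^(j+1), whose logarithm is the term (j + 1) log 2.
  have hsum : HasSum (fun j : ℕ => δ / 2 / 2 ^ j) δ := hasSum_geometric_two' δ
  have hsum' : ENNReal.ofReal δ = ∑' j : ℕ, ENNReal.ofReal (δ / 2 / 2 ^ j) := by
    rw [← ENNReal.ofReal_tsum_of_nonneg (fun j => by positivity) hsum.summable, hsum.tsum_eq]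
  rw [hsum']
  refine ENNReal.tsum_le_tsum fun j => ?_
  by_cases hj : scaleTemp M L j ≤ 1 / 2
  · refine (measure_mono ?_).trans (measure_pacBayes_le D hX hy hs hY (l := scaleTemp M L j)
      (Real.sqrt_nonneg _) hj (δ := δ / 2 / 2 ^ j) (by positivity))
    rintro s ⟨-, h, hh, hlt⟩
    refine ⟨h, hh, lt_of_eq_of_lt ?_ hlt⟩
    have : (1 : ℝ) / (δ / 2 / 2 ^ j) = 1 / δ * 2 ^ (j + 1) := by
      rw [pow_succ]; field_simp
    rw [this, Real.log_mul (by positivity) (by positivity), Real.log_pow]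
    push_cast
    ring
  · simp only [hj, false_and]
    simp

/-- A quantile of a bounded nonnegative random variable. -/
theorem exists_quantile {m : Z → ℝ} (hm : Measurable m) (hm0 : ∀ z, 0 ≤ m z) {C : ℝ} (hC0 : 0 ≤ C)
    (hC : ∀ᵐ z ∂D, m z ≤ C) {β : ℝ} (hβ : 0 ≤ β) :
    ∃ t, 0 ≤ t ∧ t ≤ C ∧ D {z | t < m z} ≤ ENNReal.ofReal β ∧
      D {z | m z < t} ≤ ENNReal.ofReal (1 - β) := by
  -- The quantile is the infimum of `A`. Continuity of `D` along increasing unions gives the tail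
  -- bounds with strict inequalities on both sides, so atoms of `m` are harmless.
  set A : Set ℝ := {s | 0 ≤ s ∧ D {z | s < m z} ≤ ENNReal.ofReal β} with hA
  have hCA : C ∈ A := by
    refine ⟨hC0, ?_⟩
    have : D {z | C < m z} = 0 := by
      rw [← nonpos_iff_eq_zero, ← ae_iff.1 hC]
      exact measure_mono fun z hz => not_le.2 hz
    rw [this]; exact zero_le
  have hbdd : BddBelow A := ⟨0, fun s hs => hs.1⟩
  have ht0 : 0 ≤ sInf A := Real.sInf_nonneg fun s hs => hs.1
  refine ⟨sInf A, ht0, csInf_le hbdd hCA, ?_, ?_⟩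
  · have hU : {z | sInf A < m z} = ⋃ k : ℕ, {z | sInf A + 1 / ((k : ℝ) + 1) < m z} := by
      ext z
      simp only [Set.mem_ofPred_eq, Set.mem_iUnion]
      constructor
      · intro h
        obtain ⟨k, hk⟩ := exists_nat_one_div_lt (sub_pos.2 h)
        exact ⟨k, by linarith⟩
      · rintro ⟨k, hk⟩
        have : 0 < 1 / ((k : ℝ) + 1) := by positivity
        linarith
    have hmono : Monotone fun k : ℕ => {z | sInf A + 1 / ((k : ℝ) + 1) < m z} := by
      intro k l hkl z hz
      have : 1 / ((l : ℝ) + 1) ≤ 1 / ((k : ℝ) + 1) := by gcongr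
      simp only [Set.mem_ofPred_eq] at hz ⊢
      linarith
    rw [hU, hmono.measure_iUnion]
    refine iSup_le fun k => ?_
    obtain ⟨a, ha, hlt⟩ := exists_lt_of_csInf_lt ⟨C, hCA⟩
      (lt_add_of_pos_right (sInf A) (by positivity : 0 < 1 / ((k : ℝ) + 1)))
    exact (measure_mono fun z hz => lt_trans hlt hz).trans ha.2
  · have hU : {z | m z < sInf A} = ⋃ k : ℕ, {z | m z ≤ sInf A - 1 / ((k : ℝ) + 1)} := by
      ext z
      simp only [Set.mem_ofPred_eq, Set.mem_iUnion]
      constructor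
      · intro h
        obtain ⟨k, hk⟩ := exists_nat_one_div_lt (sub_pos.2 h)
        exact ⟨k, by linarith⟩
      · rintro ⟨k, hk⟩
        have : 0 < 1 / ((k : ℝ) + 1) := by positivity
        linarith
    have hmono : Monotone fun k : ℕ => {z | m z ≤ sInf A - 1 / ((k : ℝ) + 1)} := by
      intro k l hkl z hz
      have : 1 / ((l : ℝ) + 1) ≤ 1 / ((k : ℝ) + 1) := by gcongr
      simp only [Set.mem_ofPred_eq] at hz ⊢
      linarith
    rw [hU, hmono.measure_iUnion]
    refine iSup_le fun k => ?_
    set r := sInf A - 1 / ((k : ℝ) + 1) with hr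
    have hrt : r < sInf A := by
      have : 0 < 1 / ((k : ℝ) + 1) := by positivity
      linarith
    rcases lt_or_ge r 0 with h0 | h0
    · have : {z | m z ≤ r} = ∅ := by
        ext z; simp only [Set.mem_ofPred_eq, Set.mem_empty_iff_false, iff_false, not_le]
        exact h0.trans_le (hm0 z)
      simp [this]
    · have h1 : ¬ D {z | r < m z} ≤ ENNReal.ofReal β := fun h => notMem_of_lt_csInf hrt hbdd ⟨h0, h⟩
      have h2 : {z | m z ≤ r} = {z | r < m z}ᶜ := by ext; simp
      rw [h2, prob_compl_eq_one_sub (measurableSet_lt measurable_const hm),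
        ENNReal.ofReal_sub _ hβ, ENNReal.ofReal_one]
      exact tsub_le_tsub_left (not_le.1 h1).le _

/-- By independence the probability is at most (1 - β)^M ≤ exp(-βM). For a quantile `t` this says
that the sample maximum of `m` reaches `t` with high probability. -/
theorem measure_forall_lt_le {M : ℕ} {m : Z → ℝ} {t β δ : ℝ} (hδ : 0 < δ)
    (hβ : Real.log (1 / δ) ≤ M * β) (h : D {z | m z < t} ≤ ENNReal.ofReal (1 - β)) :
    (Measure.pi fun _ : Fin M => D) {s | ∀ i, m (s i) < t} ≤ ENNReal.ofReal δ := by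
  have h1 : {s : Fin M → Z | ∀ i, m (s i) < t} = Set.univ.pi fun _ => {z | m z < t} := by
    ext s; simp
  rw [h1, Measure.pi_pi, Finset.prod_const, Finset.card_univ, Fintype.card_fin]
  calc D {z | m z < t} ^ M ≤ ENNReal.ofReal (Real.exp (-β)) ^ M := by
        gcongr
        refine h.trans (ENNReal.ofReal_le_ofReal ?_)
        linarith [Real.add_one_le_exp (-β)]
    _ = ENNReal.ofReal (Real.exp (M * -β)) := by
        rw [← ENNReal.ofReal_pow (Real.exp_pos _).le, ← Real.exp_nat_mul]
    _ ≤ ENNReal.ofReal δ := by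
        refine ENNReal.ofReal_le_ofReal ?_
        rw [← Real.le_log_iff_exp_le hδ]
        rw [one_div, Real.log_inv] at hβ
        linarith

end Uniform

/-! ### Normalization and truncation of the data -/

section Truncation

variable {Z : Type*} [MeasurableSpace Z] {n K : ℕ} {X : Z → Fin K → Vec n} {y : Z → Vec n}
  (D : Measure Z) [IsProbabilityMeasure D]

theorem comb_smul_left {n K : ℕ} (c : ℝ) (v : Fin K → Vec n) (w : Vec K) :
    comb (fun k => c • v k) w = c • comb v w := by
  simp only [comb, Finset.smul_sum]
  exact Finset.sum_congr rfl fun k _ => smul_comm _ _ _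

theorem sqSize_smul {n K : ℕ} (c : ℝ) (v : Fin K → Vec n) :
    sqSize (fun k => c • v k) = c ^ 2 * sqSize v := by
  simp [sqSize, norm_smul, mul_pow, Finset.mul_sum]

theorem comb_eq_zero {n K : ℕ} {v : Fin K → Vec n} (hv : sqSize v = 0) (w : Vec K) :
    comb v w = 0 := by
  have h := norm_comb_sq_le v w
  rw [hv, zero_mul] at h
  simpa using le_antisymm h (sq_nonneg _)

set_option maxHeartbeats 1000000 in
/-- Uniform deviation bound for the linear predictors whose loss is at most `ρ ^ 2` almost surely,
in terms of a lower bound `t` of the largest square size in the sample. -/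
theorem exists_uniform_deviation (hX : ∀ k, Measurable fun z => X z k) (hy : Measurable y)
    {C : ℝ} (hC0 : 0 ≤ C) (hC : ∀ᵐ z ∂D, sqSize (X z) ≤ C) {Y : ℝ} (hY : ∀ᵐ z ∂D, ‖y z‖ ≤ Y)
    {ρ : ℝ} (hρ : 0 < ρ) {M : ℕ} (hM : 0 < M) {δ : ℝ} (hδ : 0 < δ) (hδ1 : δ ≤ 1) :
    ∃ t, 0 ≤ t ∧ t ≤ C ∧ (Measure.pi fun _ : Fin M => D) {s | ¬ ((∃ i, t ≤ sqSize (X (s i))) ∧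
      ∀ h : Vec K, (∀ᵐ z ∂D, ‖comb (X z) h - y z‖ ≤ ρ) →
        2 * (√t * ‖h‖ / ρ) ^ 2 + 7 * Real.log (4 / δ) ≤ 0.26 * M →
        ∫ z, ‖comb (X z) h - y z‖ ^ 2 ∂D - (1 / (M : ℝ)) * ∑ i, ‖comb (X (s i)) h - y (s i)‖ ^ 2
          ≤ ρ ^ 2 * (2.75 * (√t * ‖h‖ / ρ) + 4.7 * √(Real.log (4 / δ))) / √M)}
      ≤ ENNReal.ofReal δ := by
  have hM' : (0 : ℝ) < M := by exact_mod_cast hM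
  set L := Real.log (4 / δ) with hL
  have hlog2 := Real.log_two_gt_d9
  have hL1 : 1.38 ≤ L := by
    have h1 : Real.log 4 ≤ L := Real.log_le_log (by norm_num) (by
      rw [le_div_iff₀ hδ]; linarith)
    have h2 : Real.log 4 = 2 * Real.log 2 := by
      rw [show (4 : ℝ) = 2 ^ 2 by norm_num, Real.log_pow]; norm_num
    linarith
  set ℓ := Real.log (1 / (δ / 2)) with hℓ
  have hℓ0 : 0 ≤ ℓ := Real.log_nonneg (by rw [le_div_iff₀ (by positivity)]; linarith)
  have hℓL : ℓ ≤ L := by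
    refine Real.log_le_log (by positivity) ?_
    rw [one_div_div]
    gcongr
    norm_num
  have hms := measurable_sqSize hX
  -- At level β = ℓ/M the discarded mass is O(log(1/δ)/M), and the sample misses the level `t` with
  -- probability at most δ/2. The other δ/2 goes to the PAC-Bayes bound.
  obtain ⟨t, ht0, htC, ht1, ht2⟩ := exists_quantile D hms (fun z => sqSize_nonneg _) hC0 hC
    (β := ℓ / M) (by positivity)
  refine ⟨t, ht0, htC, ?_⟩
  -- The value 1 only guards against division by zero when t = 0.
  set T : ℝ := if t = 0 then 1 else t with hT
  have hT0 : 0 < T := by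
    rw [hT]; split_ifs with h
    · exact one_pos
    · exact lt_of_le_of_ne ht0 (Ne.symm h)
  have htT : t ≤ T := by
    rw [hT]; split_ifs with h
    · rw [h]; norm_num
    · exact le_rfl
  set E0 : Set Z := {z | sqSize (X z) ≤ t ∧ ‖y z‖ ≤ Y} with hE0
  have hE0m : MeasurableSet E0 :=
    (measurableSet_le hms measurable_const).inter (measurableSet_le hy.norm measurable_const)
  classical
  set c : ℝ := 1 / √(2 * T) with hc
  have hc2 : c ^ 2 = 1 / (2 * T) := by
    rw [hc, div_pow, Real.sq_sqrt (by positivity)]; norm_num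
  -- Data outside `E0` become zero, so their transformed loss is 0. Inside, the scaling by `c` gives
  -- `sqSize` at most 1/2, and outputs are divided by ρ.
  set X' : Z → Fin K → Vec n := fun z k => if z ∈ E0 then c • X z k else 0 with hX'
  set y' : Z → Vec n := fun z => if z ∈ E0 then (1 / ρ) • y z else 0 with hy'
  have hX'm : ∀ k, Measurable fun z => X' z k := fun k =>
    Measurable.ite hE0m ((hX k).const_smul c) measurable_const
  have hy'm : Measurable y' := by
    have h1 : Measurable fun z => (1 / ρ) • y z := hy.const_smul (1 / ρ)
    exact Measurable.ite hE0m h1 measurable_const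
  have hs' : ∀ z, sqSize (X' z) ≤ 1 / 2 := by
    intro z
    by_cases hz : z ∈ E0
    · have : X' z = fun k => c • X z k := by ext1 k; simp [hX', hz]
      rw [this, sqSize_smul, hc2]
      have h1 := hz.1.trans htT
      calc 1 / (2 * T) * sqSize (X z) ≤ 1 / (2 * T) * T := by gcongr
        _ = 1 / 2 := by field_simp
    · have : X' z = fun _ => 0 := by ext1 k; simp [hX', hz]
      rw [this]; simp [sqSize]
  have hY' : ∀ z, ‖y' z‖ ≤ 1 / ρ * |Y| := by
    intro z
    by_cases hz : z ∈ E0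
    · simp only [hy', hz, if_true, norm_smul, Real.norm_eq_abs]
      rw [abs_of_pos (by positivity)]
      gcongr
      exact hz.2.trans (le_abs_self _)
    · simp only [hy', hz, if_false, norm_zero]
      positivity
  -- Coefficients are rescaled so that residuals on `E0` are exactly divided by ρ. For t = 0 the
  -- features vanish on `E0`, and the zero predictor does the same at no cost.
  set φ : Vec K → Vec K := fun h => if t = 0 then 0 else (√(2 * T) / ρ) • h with hφ
  have hin : ∀ z ∈ E0, ∀ h, comb (X' z) (φ h) - y' z = (1 / ρ) • (comb (X z) h - y z) := by
    intro z hz h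
    have h1 : X' z = fun k => c • X z k := by ext1 k; simp [hX', hz]
    have h2 : y' z = (1 / ρ) • y z := by simp [hy', hz]
    rw [h1, h2, comb_smul_left, smul_sub]
    congr 1
    by_cases h0 : t = 0
    · have : sqSize (X z) = 0 := le_antisymm (h0 ▸ hz.1) (sqSize_nonneg _)
      rw [comb_eq_zero this, comb_eq_zero this]; simp
    · simp only [hφ, h0, if_false]
      rw [comb_smul, smul_smul]
      congr 1
      have : √(2 * T) ≠ 0 := by positivity
      rw [hc]; field_simp
  have hout : ∀ z, z ∉ E0 → ∀ h, comb (X' z) (φ h) - y' z = 0 := by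
    intro z hz h
    simp [hX', hy', hz, comb]
  have hφn : ∀ h, ‖φ h‖ ^ 2 / 2 = (√t * ‖h‖ / ρ) ^ 2 := by
    intro h
    by_cases h0 : t = 0
    · simp [hφ, h0]
    · have hTt : T = t := by simp [hT, h0]
      simp only [hφ, h0, if_false, norm_smul, hTt, Real.norm_eq_abs]
      rw [abs_of_nonneg (by positivity), div_mul_eq_mul_div, div_pow, div_pow, mul_pow, mul_pow,
        Real.sq_sqrt (by positivity), Real.sq_sqrt ht0]
      ring
  have hpb := measure_pacBayes_scales_le D (M := M) hX'm hy'm hs' hY' L (half_pos hδ)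
  have hqu := measure_forall_lt_le D (M := M) (half_pos hδ)
    (by rw [mul_div_cancel₀ _ hM'.ne'] : Real.log (1 / (δ / 2)) ≤ M * (ℓ / M)) ht2
  have hE0c : D.real E0ᶜ ≤ ℓ / M := by
    refine ENNReal.toReal_le_of_le_ofReal (by positivity) (le_trans ?_ ht1)
    refine measure_mono_ae ?_
    filter_upwards [hY] with z hz hz0
    by_contra h1
    exact hz0 ⟨not_lt.1 h1, hz⟩
  have hδ2 : ENNReal.ofReal δ = ENNReal.ofReal (δ / 2) + ENNReal.ofReal (δ / 2) := by
    rw [← ENNReal.ofReal_add (by positivity) (by positivity), add_halves]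
  rw [hδ2]
  refine (measure_mono ?_).trans ((measure_union_le _ _).trans (add_le_add hqu hpb))
  intro s hs
  by_contra hcon
  rw [Set.mem_union, not_or] at hcon
  obtain ⟨hc1, hc2'⟩ := hcon
  refine hs ⟨by simpa using hc1, fun h hh hcond => ?_⟩
  set γ := √t * ‖h‖ / ρ with hγ
  have hγ0 : 0 ≤ γ := by positivity
  have hh' : ∀ᵐ z ∂D, ‖comb (X' z) (φ h) - y' z‖ ≤ 1 := by
    filter_upwards [hh] with z hz
    by_cases hz0 : z ∈ E0
    · rw [hin z hz0, norm_smul, Real.norm_eq_abs, abs_of_pos (by positivity)]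
      rw [one_div, inv_mul_le_iff₀ hρ]; simpa using hz
    · rw [hout z hz0]; simp
  obtain ⟨j, hj1, hj0, hj2⟩ := exists_scale (G := γ ^ 2) (sq_nonneg _) hL1 hℓL hM' (by linarith)
  have key : ¬ _ := fun hlt => hc2' ⟨j, hj1, φ h, hh', hlt⟩
  rw [not_lt, hφn] at key
  have key2 := le_of_mul_le_mul_left (key.trans hj2) hj0
  rw [Real.sqrt_sq hγ0, Finset.sum_sub_distrib] at key2
  simp only [Finset.sum_const, Finset.card_univ, Fintype.card_fin, nsmul_eq_mul] at key2
  set Ig := ∫ z, ‖comb (X' z) (φ h) - y' z‖ ^ 2 ∂D with hIg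
  set Sg := ∑ i, ‖comb (X' (s i)) (φ h) - y' (s i)‖ ^ 2 with hSg
  have hsq : ∀ z ∈ E0, ‖comb (X z) h - y z‖ ^ 2 = ρ ^ 2 * ‖comb (X' z) (φ h) - y' z‖ ^ 2 := by
    intro z hz
    rw [hin z hz, norm_smul, mul_pow, Real.norm_eq_abs, sq_abs]
    field_simp
  have hI1 : Integrable (fun z => ‖comb (X' z) (φ h) - y' z‖ ^ 2) D := by
    refine Integrable.of_bound (C := 1)
      (((measurable_comb_left hX'm (φ h)).sub hy'm).norm.pow_const 2).aestronglyMeasurable ?_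
    filter_upwards [hh'] with z hz
    rw [norm_pow, norm_norm]
    exact pow_le_one₀ (norm_nonneg _) hz
  have hI2 : Integrable (fun z => ‖comb (X z) h - y z‖ ^ 2) D := by
    refine Integrable.of_bound (C := ρ ^ 2)
      (((measurable_comb_left hX h).sub hy).norm.pow_const 2).aestronglyMeasurable ?_
    filter_upwards [hh] with z hz
    rw [norm_pow, norm_norm]
    gcongr
  have hI3 : Integrable (E0ᶜ.indicator fun _ => (1 : ℝ)) D :=
    (integrable_const _).indicator hE0m.compl
  -- Truncation lowers the population loss by at most ρ² times the discarded mass, since admissible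
  -- losses are at most ρ². On the sample it can only lower the loss, which is the favourable
  -- direction.
  have hint : ∫ z, ‖comb (X z) h - y z‖ ^ 2 ∂D ≤ ρ ^ 2 * Ig + ρ ^ 2 * (ℓ / M) := by
    calc _ ≤ ∫ z, (ρ ^ 2 * ‖comb (X' z) (φ h) - y' z‖ ^ 2
          + ρ ^ 2 * E0ᶜ.indicator (fun _ => (1 : ℝ)) z) ∂D := by
          refine integral_mono_ae hI2 ((hI1.const_mul _).add (hI3.const_mul _)) ?_
          filter_upwards [hh] with z hz
          by_cases hz0 : z ∈ E0
          · simp [hz0, hsq z hz0]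
          · simp only [hout z hz0, Set.mem_compl_iff, hz0, not_false_eq_true,
              Set.indicator_of_mem]
            simp only [norm_zero]
            have : ‖comb (X z) h - y z‖ ^ 2 ≤ ρ ^ 2 := by gcongr
            linarith
      _ = ρ ^ 2 * Ig + ρ ^ 2 * D.real E0ᶜ := by
          rw [integral_add (hI1.const_mul _) (hI3.const_mul _), integral_const_mul,
            integral_const_mul, integral_indicator_const _ hE0m.compl, smul_eq_mul, mul_one]
      _ ≤ _ := by gcongr
  have hsum : ρ ^ 2 * Sg ≤ ∑ i, ‖comb (X (s i)) h - y (s i)‖ ^ 2 := by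
    rw [hSg, Finset.mul_sum]
    refine Finset.sum_le_sum fun i _ => ?_
    by_cases hz0 : s i ∈ E0
    · rw [hsq _ hz0]
    · rw [hout _ hz0]; simp
  set a := √L
  have ha2 : a ^ 2 = L := Real.sq_sqrt (by linarith)
  have ha0 : 0 ≤ a := Real.sqrt_nonneg _
  set q := √(M : ℝ)
  have hq2 : q ^ 2 = M := Real.sq_sqrt hM'.le
  have hq0 : 0 < q := Real.sqrt_pos.2 hM'
  have haq : a ≤ 0.2 * q := by
    refine le_of_sq_le_sq ?_ (by positivity)
    rw [mul_pow, ha2, hq2]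
    linarith [sq_nonneg γ]
  -- The discarded mass adds ℓ ≤ L ≤ 0.2√M√L, whence 4.7 = 4.5 + 0.2.
  have hfin : M * (Ig + ℓ / M) - Sg ≤ q * (2.75 * γ + 4.7 * a) := by
    have h1 : (M : ℝ) * (Ig + ℓ / M) = M * Ig + ℓ := by field_simp
    have h2 : ℓ ≤ q * (0.2 * a) := by
      calc ℓ ≤ a * a := by rw [← sq, ha2]; exact hℓL
        _ ≤ 0.2 * q * a := by gcongr
        _ = q * (0.2 * a) := by ring
    rw [h1]
    linarith
  rw [← hq2] at hfin ⊢
  rw [le_div_iff₀ hq0]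
  rw [← hq2] at hint
  have h3 : (∫ z, ‖comb (X z) h - y z‖ ^ 2 ∂D - 1 / q ^ 2 * ∑ i, ‖comb (X (s i)) h - y (s i)‖ ^ 2)
      ≤ (ρ ^ 2 * (Ig + ℓ / q ^ 2)) - 1 / q ^ 2 * (ρ ^ 2 * Sg) := by
    have : 1 / q ^ 2 * (ρ ^ 2 * Sg) ≤ 1 / q ^ 2 * ∑ i, ‖comb (X (s i)) h - y (s i)‖ ^ 2 := by
      gcongr
    linarith
  calc _ ≤ ((ρ ^ 2 * (Ig + ℓ / q ^ 2)) - 1 / q ^ 2 * (ρ ^ 2 * Sg)) * q := by gcongr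
    _ = ρ ^ 2 * (q ^ 2 * (Ig + ℓ / q ^ 2) - Sg) / q := by field_simp
    _ ≤ ρ ^ 2 * (q * (2.75 * γ + 4.7 * a)) / q := by gcongr
    _ = _ := by field_simp

end Truncation

/-! ### Gradient descent and the pseudo-inverse -/

section GradientDescent

/-- Gradient descent on a quadratic with minimizer `v` stays within `‖h₀‖ + ‖v‖` of the origin. -/
theorem norm_linear_iterate_le {E : Type*} [NormedAddCommGroup E] [InnerProductSpace ℝ E]
    [FiniteDimensional ℝ E] {T : E →ₗ[ℝ] E} (hT : T.IsSymmetric) {η : ℝ} (hη : 0 ≤ η)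
    (h0 : ∀ x, 0 ≤ ⟪T x, x⟫) (h1 : ∀ x, η * ⟪T x, x⟫ ≤ ‖x‖ ^ 2) {v : E} {h : ℕ → E}
    (hh : ∀ t, h (t + 1) = h t - η • T (h t - v)) (t : ℕ) : ‖h t‖ ≤ ‖h 0‖ + ‖v‖ := by
  set b := hT.eigenvectorBasis rfl with hb
  set p : Fin (Module.finrank ℝ E) → ℝ := fun i => 1 - η * hT.eigenvalues rfl i with hp
  have hTb : ∀ i, T (b i) = hT.eigenvalues rfl i • b i := fun i => by
    exact hT.apply_eigenvectorBasis rfl i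
  have hval : ∀ i, ⟪T (b i), b i⟫ = hT.eigenvalues rfl i := fun i => by
    rw [hTb, real_inner_smul_left, real_inner_self_eq_norm_sq, b.norm_eq_one]; simp
  have hp0 : ∀ i, 0 ≤ p i := fun i => by
    have := h1 (b i)
    rw [hval, b.norm_eq_one] at this
    simp only [hp]; linarith
  have hp1 : ∀ i, p i ≤ 1 := fun i => by
    have := h0 (b i)
    rw [hval] at this
    simp only [hp]; nlinarith
  -- In an eigenbasis the recursion is scalar with contraction factor pᵢ ∈ [0, 1], so its solution
  -- is a convex combination of the initial and the target coordinate.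
  have hc : ∀ i t, ⟪b i, h t⟫ = p i ^ t * ⟪b i, h 0⟫ + (1 - p i ^ t) * ⟪b i, v⟫ := by
    intro i t
    induction t with
    | zero => simp
    | succ t ih =>
      have hs : ⟪b i, T (h t - v)⟫ = hT.eigenvalues rfl i * (⟪b i, h t⟫ - ⟪b i, v⟫) := by
        rw [← hT (b i), hTb, real_inner_smul_left, inner_sub_right]
      rw [hh, inner_sub_right, real_inner_smul_right, hs, ih]
      have : hT.eigenvalues rfl i * η = 1 - p i := by simp only [hp]; ring
      linear_combination (-(p i ^ t * ⟪b i, h 0⟫ + (1 - p i ^ t) * ⟪b i, v⟫ - ⟪b i, v⟫)) * this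
  have hn : ∀ x : E, ‖x‖ ^ 2 = ∑ i, ⟪b i, x⟫ ^ 2 := fun x => (b.sum_sq_inner_right x).symm
  set u : E := ∑ i, (p i ^ t * ⟪b i, h 0⟫) • b i with hu
  set w : E := ∑ i, ((1 - p i ^ t) * ⟪b i, v⟫) • b i with hw
  have hsum : h t = u + w := by
    rw [hu, hw, ← Finset.sum_add_distrib, ← b.sum_repr' (h t)]
    refine Finset.sum_congr rfl fun i _ => ?_
    rw [hc, add_smul]
  have hcontr : ∀ (c : Fin (Module.finrank ℝ E) → ℝ) (x : E), (∀ i, 0 ≤ c i) → (∀ i, c i ≤ 1) →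
      ‖∑ i, (c i * ⟪b i, x⟫) • b i‖ ≤ ‖x‖ := by
    intro c x hc0 hc1
    refine le_of_sq_le_sq ?_ (norm_nonneg _)
    rw [hn, hn x]
    refine Finset.sum_le_sum fun i _ => ?_
    rw [b.orthonormal.inner_right_fintype, mul_pow]
    exact mul_le_of_le_one_left (sq_nonneg _) (pow_le_one₀ (hc0 i) (hc1 i))
  rw [hsum]
  refine (norm_add_le _ _).trans (add_le_add ?_ ?_)
  · exact hcontr _ _ (fun i => pow_nonneg (hp0 i) t) fun i => pow_le_one₀ (hp0 i) (hp1 i)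
  · exact hcontr _ _ (fun i => sub_nonneg.2 (pow_le_one₀ (hp0 i) (hp1 i)))
      fun i => sub_le_self _ (pow_nonneg (hp0 i) t)

theorem IsMoorePenrose.transpose_eq {ι : Type*} [Fintype ι] {A B : Matrix ι ι ℝ}
    (h : IsMoorePenrose A B) (hA : Aᵀ = A) : Bᵀ = B := by
  refine IsMoorePenrose.unique (A := A) ⟨?_, ?_, ?_, ?_⟩ h
  · have := congrArg Matrix.transpose h.mul_mul_self
    simpa [Matrix.transpose_mul, hA, Matrix.mul_assoc] using this
  · have := congrArg Matrix.transpose h.self_mul_mul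
    simpa [Matrix.transpose_mul, hA, Matrix.mul_assoc] using this
  · have h2 := h.symm_right
    rw [Matrix.transpose_mul, hA] at h2
    rw [Matrix.transpose_mul, Matrix.transpose_transpose, hA, h2]
  · have h2 := h.symm_left
    rw [Matrix.transpose_mul, hA] at h2
    rw [Matrix.transpose_mul, Matrix.transpose_transpose, hA, h2]

/-- With Θ = AAᵀ, the Gram matrix of Aᵀ(1 - ΘB) is (1 - ΘB)ᵀΘ(1 - ΘB), which vanishes because Θ(ΘB)
= Θ. This makes AᵀBo a solution of the normal equations for every right-hand side `o`. -/
theorem IsMoorePenrose.transpose_mul_mul {ι κ : Type*} [Fintype ι] [Fintype κ] [DecidableEq ι]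
    {A : Matrix ι κ ℝ} {B : Matrix ι ι ℝ} (h : IsMoorePenrose (A * Aᵀ) B) :
    Aᵀ * (A * Aᵀ * B) = Aᵀ := by
  have hs : (A * Aᵀ)ᵀ = A * Aᵀ := by simp [Matrix.transpose_mul]
  set Θ := A * Aᵀ with hΘ
  have h1 : Θ * (Θ * B) = Θ := by
    have := congrArg Matrix.transpose h.mul_mul_self
    rwa [Matrix.transpose_mul, h.symm_left, hs] at this
  have h2 : (Aᵀ * (1 - Θ * B))ᵀ * (Aᵀ * (1 - Θ * B)) = 0 := by
    rw [Matrix.transpose_mul, Matrix.transpose_transpose, Matrix.mul_assoc, ← Matrix.mul_assoc A,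
      ← hΘ, Matrix.mul_sub, Matrix.mul_one, h1, sub_self, Matrix.mul_zero]
  have h3 : Aᵀ * (1 - Θ * B) = 0 := by
    rw [← Matrix.conjTranspose_eq_transpose_of_trivial (Aᵀ * (1 - Θ * B))] at h2
    exact Matrix.conjTranspose_mul_self_eq_zero.1 h2
  rw [Matrix.mul_sub, Matrix.mul_one, sub_eq_zero] at h3
  exact h3.symm

variable {n K M : ℕ} (S : Matrix (Fin n) (Fin n) ℝ) (z : Fin M → Vec n × Vec n)

/-- The stacked feature matrix, with rows indexed by samples and nodes. -/
def featureMatrix (K : ℕ) {n M : ℕ} (S : Matrix (Fin n) (Fin n) ℝ) (z : Fin M → Vec n × Vec n) :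
    Matrix (Fin M × Fin n) (Fin K) ℝ :=
  Matrix.of fun u k => shiftPow S k (z u.1).1 u.2

theorem ntk_eq_mul_transpose (h : Vec K) :
    ntk (graphFilter K S) z h = featureMatrix K S z * (featureMatrix K S z)ᵀ := by
  ext u v
  rw [ntk_graphFilter]
  simp [featureMatrix, Matrix.mul_apply]

theorem objective_eq (h : Vec K) : objective (graphFilter K S) z h =
    1 / 2 * ‖(WithLp.toLp 2 (featureMatrix K S z *ᵥ h.ofLp - stackedOutput z) :
      EuclideanSpace ℝ (Fin M × Fin n))‖ ^ 2 := by
  rw [objective, EuclideanSpace.real_norm_sq_eq, Fintype.sum_prod_type]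
  congr 1
  refine Finset.sum_congr rfl fun i _ => ?_
  rw [EuclideanSpace.real_norm_sq_eq]
  refine Finset.sum_congr rfl fun a _ => ?_
  simp only [graphFilter, featureMatrix, stackedOutput, Matrix.mulVec, dotProduct, PiLp.sub_apply,
    Pi.sub_apply, Matrix.of_apply, WithLp.ofLp_sum, Finset.sum_apply, smul_eq_mul,
    WithLp.ofLp_smul, Pi.smul_apply]
  simp_rw [mul_comm]
  ring

theorem gradient_objective (h : Vec K) : gradient (objective (graphFilter K S) z) h =
    WithLp.toLp 2 ((featureMatrix K S z)ᵀ *ᵥ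
      (featureMatrix K S z *ᵥ h.ofLp - stackedOutput z)) := by
  set A := featureMatrix K S z
  set L : Vec K →L[ℝ] EuclideanSpace ℝ (Fin M × Fin n) :=
    LinearMap.toContinuousLinearMap (Matrix.toEuclideanLin A)
  set o : EuclideanSpace ℝ (Fin M × Fin n) := WithLp.toLp 2 (stackedOutput z)
  have h1 : objective (graphFilter K S) z = fun h => 1 / 2 * ‖L h - o‖ ^ 2 := by
    ext h
    rw [objective_eq]
    rfl
  have h2 : HasFDerivAt (fun h => 1 / 2 * ‖L h - o‖ ^ 2)
      ((1 / 2 : ℝ) • (2 • (innerSL ℝ (L h - o)).comp L)) h :=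
    ((L.hasFDerivAt.sub_const o).norm_sq).const_mul (1 / 2)
  have h3 : InnerProductSpace.toDual ℝ (Vec K) (WithLp.toLp 2 (Aᵀ *ᵥ (A *ᵥ h.ofLp - stackedOutput z)))
      = (1 / 2 : ℝ) • (2 • (innerSL ℝ (L h - o)).comp L) := by
    refine ContinuousLinearMap.ext fun w => ?_
    have h4 : ⟪(WithLp.toLp 2 (Aᵀ *ᵥ (A *ᵥ h.ofLp - stackedOutput z)) : Vec K), w⟫
        = (Aᵀ *ᵥ (A *ᵥ h.ofLp - stackedOutput z)) ⬝ᵥ w.ofLp := by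
      simp [EuclideanSpace.inner_eq_star_dotProduct, dotProduct_comm]
    have h5 : ⟪L h - o, L w⟫ = (A *ᵥ h.ofLp - stackedOutput z) ⬝ᵥ (A *ᵥ w.ofLp) := by
      rw [EuclideanSpace.inner_eq_star_dotProduct]
      simp only [star_trivial, dotProduct_comm]
      rfl
    rw [InnerProductSpace.toDual_apply_apply, h4, Matrix.mulVec_transpose,
      ← Matrix.dotProduct_mulVec, ← h5]
    simp [inner_sub_left]
  refine HasGradientAt.gradient ?_
  rw [hasGradientAt_iff_hasFDerivAt, h1, h3]
  exact h2

/-- The learning rate is restricted through AAᵀ, while gradient descent is driven by AᵀA. The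
transfer is ‖Ax‖⁴ = ⟨x, AᵀAx⟩² ≤ ‖x‖²‖AᵀAx‖² ≤ ‖x‖²‖AAᵀ‖‖Ax‖². -/
theorem mulVec_dotProduct_self_le {ι κ : Type*} [Fintype ι] [Fintype κ] [DecidableEq ι]
    (A : Matrix ι κ ℝ) (x : κ → ℝ) :
    (A *ᵥ x) ⬝ᵥ (A *ᵥ x) ≤ ‖Matrix.toEuclideanCLM (𝕜 := ℝ) (A * Aᵀ)‖ * (x ⬝ᵥ x) := by
  set θ := ‖Matrix.toEuclideanCLM (𝕜 := ℝ) (A * Aᵀ)‖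
  set w := A *ᵥ x with hw
  have hw0 : 0 ≤ w ⬝ᵥ w := Finset.sum_nonneg fun i _ => mul_self_nonneg _
  have hx0 : 0 ≤ x ⬝ᵥ x := Finset.sum_nonneg fun i _ => mul_self_nonneg _
  have h1 : w ⬝ᵥ w = x ⬝ᵥ (Aᵀ *ᵥ w) := by
    rw [Matrix.mulVec_transpose, dotProduct_comm x, ← Matrix.dotProduct_mulVec]
  have h2 : (Aᵀ *ᵥ w) ⬝ᵥ (Aᵀ *ᵥ w) ≤ θ * (w ⬝ᵥ w) := by
    have e : (Aᵀ *ᵥ w) ⬝ᵥ (Aᵀ *ᵥ w) = w ⬝ᵥ ((A * Aᵀ) *ᵥ w) := by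
      rw [← Matrix.mulVec_mulVec, Matrix.dotProduct_mulVec w A, ← Matrix.mulVec_transpose]
    have hle := real_inner_le_norm (WithLp.toLp 2 w : EuclideanSpace ℝ ι)
      (Matrix.toEuclideanCLM (𝕜 := ℝ) (A * Aᵀ) (WithLp.toLp 2 w))
    have hop := (Matrix.toEuclideanCLM (𝕜 := ℝ) (A * Aᵀ)).le_opNorm (WithLp.toLp 2 w)
    have hin : ⟪(WithLp.toLp 2 w : EuclideanSpace ℝ ι),
        Matrix.toEuclideanCLM (𝕜 := ℝ) (A * Aᵀ) (WithLp.toLp 2 w)⟫ = w ⬝ᵥ ((A * Aᵀ) *ᵥ w) := by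
      rw [EuclideanSpace.inner_eq_star_dotProduct]
      simp [dotProduct_comm]
    have hnorm : ‖(WithLp.toLp 2 w : EuclideanSpace ℝ ι)‖ * ‖(WithLp.toLp 2 w : EuclideanSpace ℝ ι)‖
        = w ⬝ᵥ w := by
      rw [← sq, EuclideanSpace.real_norm_sq_eq]
      simp [dotProduct, sq]
    rw [e, ← hin]
    calc _ ≤ _ := hle
      _ ≤ ‖(WithLp.toLp 2 w : EuclideanSpace ℝ ι)‖ * (θ * ‖(WithLp.toLp 2 w : EuclideanSpace ℝ ι)‖) := by
          gcongr
      _ = _ := by rw [← hnorm]; ring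
  have h3 : (w ⬝ᵥ w) ^ 2 ≤ (x ⬝ᵥ x) * ((Aᵀ *ᵥ w) ⬝ᵥ (Aᵀ *ᵥ w)) := by
    rw [h1]
    have := Finset.sum_mul_sq_le_sq_mul_sq Finset.univ x (Aᵀ *ᵥ w)
    simpa [dotProduct, sq] using this
  rcases hw0.eq_or_lt with h0 | h0
  · rw [← h0]; positivity
  · have h4 : (w ⬝ᵥ w) * (w ⬝ᵥ w) ≤ (θ * (x ⬝ᵥ x)) * (w ⬝ᵥ w) := by
      calc _ ≤ (x ⬝ᵥ x) * ((Aᵀ *ᵥ w) ⬝ᵥ (Aᵀ *ᵥ w)) := by rw [← sq]; exact h3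
        _ ≤ (x ⬝ᵥ x) * (θ * (w ⬝ᵥ w)) := by gcongr
        _ = _ := by ring
    exact le_of_mul_le_mul_right h4 h0

theorem ofLp_dotProduct_self {ι : Type*} [Fintype ι] (x : EuclideanSpace ℝ ι) :
    x.ofLp ⬝ᵥ x.ofLp = ‖x‖ ^ 2 := by
  rw [EuclideanSpace.real_norm_sq_eq]
  simp [dotProduct, sq]

/-- Trained parameters have norm at most `‖h₀‖ + √(ỹᵀ Θ̃† ỹ)`. -/
theorem norm_trained_le {η : ℝ} (hη : 0 < η) (h₀ : Vec K)
    (hηΘ : η * ‖Matrix.toEuclideanCLM (𝕜 := ℝ) (ntk (graphFilter K S) z h₀)‖ ≤ 1)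
    {h : Vec K} (hh : h ∈ trained (graphFilter K S) z η h₀) :
    0 ≤ stackedOutput z ⬝ᵥ (pinv (ntk (graphFilter K S) z h₀) *ᵥ stackedOutput z) ∧
    ‖h‖ ≤ ‖h₀‖ +
      √(stackedOutput z ⬝ᵥ (pinv (ntk (graphFilter K S) z h₀) *ᵥ stackedOutput z)) := by
  have hMP := isMoorePenrose_pinv (ntk_isHermitian (graphFilter K S) z h₀)
  rw [ntk_eq_mul_transpose] at hMP hηΘ ⊢
  set A := featureMatrix K S z with hA
  set B := pinv (A * Aᵀ)
  set o := stackedOutput z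
  have hBs : Bᵀ = B := hMP.transpose_eq (by simp [Matrix.transpose_mul])
  set v : Vec K := WithLp.toLp 2 (Aᵀ *ᵥ (B *ᵥ o)) with hv
  have hvn : ‖v‖ ^ 2 = o ⬝ᵥ (B *ᵥ o) := by
    rw [← ofLp_dotProduct_self]
    change (Aᵀ *ᵥ (B *ᵥ o)) ⬝ᵥ (Aᵀ *ᵥ (B *ᵥ o)) = _
    have e1 : (Aᵀ *ᵥ (B *ᵥ o)) ⬝ᵥ (Aᵀ *ᵥ (B *ᵥ o)) = (B *ᵥ o) ⬝ᵥ ((A * Aᵀ) *ᵥ (B *ᵥ o)) := by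
      rw [← Matrix.mulVec_mulVec, Matrix.dotProduct_mulVec (B *ᵥ o) A, ← Matrix.mulVec_transpose]
    have e2 : B *ᵥ o = o ᵥ* B := by
      conv_lhs => rw [← hBs, Matrix.mulVec_transpose]
    rw [e1]
    conv_lhs => rw [e2]
    rw [← Matrix.dotProduct_mulVec, ← e2, Matrix.mulVec_mulVec, Matrix.mulVec_mulVec,
      hMP.self_mul_mul]
  have hnormal : Aᵀ *ᵥ (A *ᵥ v.ofLp) = Aᵀ *ᵥ o := by
    change Aᵀ *ᵥ (A *ᵥ (Aᵀ *ᵥ (B *ᵥ o))) = _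
    rw [Matrix.mulVec_mulVec, Matrix.mulVec_mulVec, Matrix.mulVec_mulVec]
    have := hMP.transpose_mul_mul
    simp only [Matrix.mul_assoc] at this ⊢
    rw [this]
  refine ⟨hvn ▸ sq_nonneg _, ?_⟩
  rw [← hvn, Real.sqrt_sq (norm_nonneg _)]
  set T : Vec K →ₗ[ℝ] Vec K := Matrix.toEuclideanLin (Aᵀ * A)
  have hTx : ∀ x : Vec K, T x = WithLp.toLp 2 (Aᵀ *ᵥ (A *ᵥ x.ofLp)) := by
    intro x
    rw [Matrix.mulVec_mulVec]
    rfl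
  have hTs : T.IsSymmetric := by
    refine Matrix.isSymmetric_toEuclideanLin_iff.2 ?_
    rw [Matrix.IsHermitian, Matrix.conjTranspose_eq_transpose_of_trivial]
    simp [Matrix.transpose_mul]
  have hTin : ∀ x : Vec K, ⟪T x, x⟫ = (A *ᵥ x.ofLp) ⬝ᵥ (A *ᵥ x.ofLp) := by
    intro x
    rw [hTx, EuclideanSpace.inner_eq_star_dotProduct]
    simp only [star_trivial]
    rw [dotProduct_comm, Matrix.mulVec_transpose, ← Matrix.dotProduct_mulVec]
  -- The normal equations at `v` rewrite the gradient as AᵀA(h - v).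
  have hstep : ∀ t, gdIterate (graphFilter K S) z η h₀ (t + 1)
      = gdIterate (graphFilter K S) z η h₀ t - η • T (gdIterate (graphFilter K S) z η h₀ t - v) := by
    intro t
    rw [gdIterate, gradient_objective, map_sub, hTx, hTx, hnormal, Matrix.mulVec_sub,
      WithLp.toLp_sub]
  have hbound : ∀ t, ‖gdIterate (graphFilter K S) z η h₀ t‖ ≤ ‖h₀‖ + ‖v‖ := by
    intro t
    refine norm_linear_iterate_le hTs hη.le (fun x => ?_) (fun x => ?_) hstep t
    · rw [hTin]; exact Finset.sum_nonneg fun i _ => mul_self_nonneg _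
    · rw [hTin, ← ofLp_dotProduct_self]
      have h1 := mulVec_dotProduct_self_le A x.ofLp
      have hx0 : 0 ≤ x.ofLp ⬝ᵥ x.ofLp := Finset.sum_nonneg fun i _ => mul_self_nonneg _
      calc _ ≤ η * (‖Matrix.toEuclideanCLM (𝕜 := ℝ) (A * Aᵀ)‖ * (x.ofLp ⬝ᵥ x.ofLp)) := by gcongr
        _ = (η * ‖Matrix.toEuclideanCLM (𝕜 := ℝ) (A * Aᵀ)‖) * (x.ofLp ⬝ᵥ x.ofLp) := by ring
        _ ≤ 1 * (x.ofLp ⬝ᵥ x.ofLp) := by gcongr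
        _ = _ := one_mul _
  rcases hh with ⟨t, rfl⟩ | hlim
  · exact hbound t
  · exact le_of_tendsto' hlim.norm hbound

end GradientDescent

/-! ### The Gaussian initialization -/

section Initialization

variable {K : ℕ}

theorem posSemidef_sq_smul_one (κ : ℝ) :
    (κ ^ 2 • (1 : Matrix (Fin K) (Fin K) ℝ)).PosSemidef :=
  Matrix.PosSemidef.one.smul (sq_nonneg κ)

instance isGaussian_initLaw (κ : ℝ) : IsGaussian (initLaw K κ) := by
  unfold initLaw
  infer_instance

theorem lintegral_norm_sq_initLaw (κ : ℝ) :
    ∫⁻ h, ENNReal.ofReal (‖h‖ ^ 2) ∂(initLaw K κ) = ENNReal.ofReal (K * κ ^ 2) := by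
  have hL2 : MemLp id 2 (initLaw K κ) := IsGaussian.memLp_two_id
  have hI : Integrable (fun h : Vec K => ‖h‖ ^ 2) (initLaw K κ) :=
    hL2.integrable_norm_pow (p := 2) (by norm_num)
  have hi : ∀ i : Fin K, Integrable (fun h : Vec K => h i ^ 2) (initLaw K κ) := by
    intro i
    refine Integrable.mono' hI (by fun_prop) (Eventually.of_forall fun h => ?_)
    rw [Real.norm_eq_abs, abs_of_nonneg (sq_nonneg _), EuclideanSpace.real_norm_sq_eq]
    exact Finset.single_le_sum (f := fun i => h i ^ 2) (fun _ _ => sq_nonneg _) (Finset.mem_univ i)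
  rw [← ofReal_integral_eq_lintegral_ofReal hI (Eventually.of_forall fun _ => sq_nonneg _)]
  congr 1
  simp_rw [EuclideanSpace.real_norm_sq_eq]
  rw [integral_finsetSum _ fun i _ => hi i]
  have h1 : ∀ i : Fin K, ∫ h : Vec K, h i ^ 2 ∂(initLaw K κ) = κ ^ 2 := by
    intro i
    have hmp := measurePreserving_eval_multivariateGaussian (μ := (0 : Vec K))
      (posSemidef_sq_smul_one (K := K) κ) (i := i)
    have hv := variance_eval_multivariateGaussian (μ := (0 : Vec K))
      (posSemidef_sq_smul_one (K := K) κ) i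
    have hm : ∫ h : Vec K, h i ∂(multivariateGaussian 0 (κ ^ 2 • (1 : Matrix (Fin K) (Fin K) ℝ)))
        = 0 := by
      have h1 := integral_map (μ := multivariateGaussian (0 : Vec K)
        (κ ^ 2 • (1 : Matrix (Fin K) (Fin K) ℝ))) (f := fun x : ℝ => x)
        hmp.measurable.aemeasurable (by fun_prop)
      rw [hmp.map_eq, integral_id_gaussianReal] at h1
      exact h1.symm
    rw [variance_of_integral_eq_zero (by fun_prop) hm] at hv
    rw [initLaw]
    simpa using hv
  simp [h1]

/-- Markov's inequality for ‖h‖², whose mean is Kκ². -/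
theorem initLaw_norm_gt_le {κ δ : ℝ} (hκ : 0 < κ) (hδ : 0 < δ) :
    initLaw K κ {h | κ * √(K / δ) < ‖h‖} ≤ ENNReal.ofReal δ := by
  rcases Nat.eq_zero_or_pos K with h0 | h0
  · subst h0
    have : {h : Vec 0 | κ * √((0 : ℕ) / δ) < ‖h‖} = ∅ := by
      ext h
      simp [Subsingleton.elim h 0]
    rw [this]; simp
  · have hK : (0 : ℝ) < K := by exact_mod_cast h0
    have hmk := meas_ge_le_lintegral_div (μ := initLaw K κ)
      (f := fun h => ENNReal.ofReal (‖h‖ ^ 2)) (by fun_prop)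
      (ε := ENNReal.ofReal (K * κ ^ 2 / δ)) (by simp; positivity) ENNReal.ofReal_ne_top
    rw [lintegral_norm_sq_initLaw] at hmk
    refine (measure_mono fun h hh => ?_).trans (hmk.trans ?_)
    · refine ENNReal.ofReal_le_ofReal ?_
      have h1 : (κ * √(K / δ)) ^ 2 = K * κ ^ 2 / δ := by
        rw [mul_pow, Real.sq_sqrt (by positivity)]; ring
      rw [← h1]
      have h2 : κ * √(K / δ) < ‖h‖ := hh
      gcongr
    · rw [← ENNReal.ofReal_div_of_pos (by positivity)]
      refine ENNReal.ofReal_le_ofReal (le_of_eq ?_)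
      field_simp

/-- The marginal in direction `a` is Gaussian with variance κ²‖a‖² > 0, hence has no atoms. -/
theorem initLaw_hyperplane {κ : ℝ} (hκ : 0 < κ) {a : Vec K} (ha : a ≠ 0) (c : ℝ) :
    initLaw K κ {h | ⟪a, h⟫ = c} = 0 := by
  have hmap := IsGaussian.map_eq_gaussianReal (μ := initLaw K κ) (innerSL ℝ a)
  have hvar : Var[innerSL ℝ a; initLaw K κ] = κ ^ 2 * ‖a‖ ^ 2 := by
    have h1 := covarianceBilin_multivariateGaussian (μ := (0 : Vec K))
      (posSemidef_sq_smul_one (K := K) κ) a a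
    have h2 := covarianceBilin_self (μ := initLaw K κ) IsGaussian.memLp_two_id a
    rw [initLaw, h1] at h2
    rw [← ofLp_dotProduct_self]
    have h3 : a.ofLp ⬝ᵥ (κ ^ 2 • (1 : Matrix (Fin K) (Fin K) ℝ)) *ᵥ a.ofLp
        = κ ^ 2 * (a.ofLp ⬝ᵥ a.ofLp) := by
      rw [Matrix.smul_mulVec, Matrix.one_mulVec, dotProduct_smul, smul_eq_mul]
    rw [← h3, h2]
    rfl
  have hne : Var[innerSL ℝ a; initLaw K κ].toNNReal ≠ 0 := by
    rw [hvar]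
    have : 0 < ‖a‖ := norm_pos_iff.2 ha
    simp only [ne_eq, Real.toNNReal_eq_zero, not_le]
    positivity
  have h1 : (initLaw K κ).map (innerSL ℝ a) {c} = 0 := by
    rw [hmap]
    have := nullSingletonClass_gaussianReal (μ := (initLaw K κ)[innerSL ℝ a]) hne
    exact measure_singleton c
  rw [Measure.map_apply (by fun_prop) (measurableSet_singleton c)] at h1
  exact h1

end Initialization

/-! ### Unbounded features -/

section Unbounded

variable {Z : Type*} [MeasurableSpace Z] {n K : ℕ} (X : Z → Fin K → Vec n) (y : Z → Vec n)
  (D : Measure Z)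

/-- The directions in which the linear predictor is almost surely bounded. -/
def boundedDirections : Submodule ℝ (Vec K) where
  carrier := {u | ∃ C : ℝ, ∀ᵐ z ∂D, ‖comb (X z) u‖ ≤ C}
  add_mem' := by
    rintro u w ⟨C, hC⟩ ⟨C', hC'⟩
    refine ⟨C + C', ?_⟩
    filter_upwards [hC, hC'] with z h1 h2
    rw [comb_add]
    exact (norm_add_le _ _).trans (add_le_add h1 h2)
  zero_mem' := ⟨0, Eventually.of_forall fun z => by simp [comb]⟩
  smul_mem' := by
    rintro c u ⟨C, hC⟩
    refine ⟨|c| * C, ?_⟩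
    filter_upwards [hC] with z h1
    rw [comb_smul, norm_smul, Real.norm_eq_abs]
    gcongr

theorem exists_bound_of_boundedDirections_eq_top (h : boundedDirections X D = ⊤) :
    ∃ C, 0 ≤ C ∧ ∀ᵐ z ∂D, sqSize (X z) ≤ C := by
  have h1 : ∀ k : Fin K, ∃ C : ℝ, ∀ᵐ z ∂D, ‖X z k‖ ≤ C := by
    intro k
    have : EuclideanSpace.single k 1 ∈ boundedDirections X D := h ▸ Submodule.mem_top
    obtain ⟨C, hC⟩ := this
    refine ⟨C, ?_⟩
    filter_upwards [hC] with z hz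
    simpa [comb, Pi.single_apply] using hz
  choose C hC using h1
  refine ⟨∑ k, C k ^ 2, Finset.sum_nonneg fun _ _ => sq_nonneg _, ?_⟩
  filter_upwards [ae_all_iff.2 hC] with z hz
  exact Finset.sum_le_sum fun k _ => pow_le_pow_left₀ (norm_nonneg _) (hz k) 2

/-- If the features are unbounded, the initialization is almost surely not an admissible
predictor. -/
theorem initLaw_admissible_eq_zero (h : boundedDirections X D ≠ ⊤) {κ : ℝ} (hκ : 0 < κ) (ρ : ℝ) :
    initLaw K κ {h | ∀ᵐ z ∂D, ‖comb (X z) h - y z‖ ≤ ρ} = 0 := by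
  set F : Set (Vec K) := {h | ∀ᵐ z ∂D, ‖comb (X z) h - y z‖ ≤ ρ}
  rcases F.eq_empty_or_nonempty with h0 | ⟨g, hg⟩
  · rw [h0]; simp
  -- Two admissible predictors differ by a bounded direction, so all of them lie in one hyperplane
  -- with normal `a`.
  obtain ⟨a, ha, ha0⟩ := Submodule.exists_mem_ne_zero_of_ne_bot
    (mt Submodule.orthogonal_eq_bot_iff.1 h)
  refine measure_mono_null (fun w hw => ?_) (initLaw_hyperplane hκ ha0 ⟪a, g⟫)
  have hmem : w - g ∈ boundedDirections X D := by
    refine ⟨ρ + ρ, ?_⟩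
    have hg' : ∀ᵐ z ∂D, ‖comb (X z) g - y z‖ ≤ ρ := hg
    have hw' : ∀ᵐ z ∂D, ‖comb (X z) w - y z‖ ≤ ρ := hw
    filter_upwards [hg', hw'] with z h1 h2
    have e : comb (X z) (w - g) = (comb (X z) w - y z) - (comb (X z) g - y z) := by
      rw [sub_eq_add_neg w g, comb_add, comb_neg]; abel
    rw [e]
    exact (norm_sub_le _ _).trans (add_le_add h2 h1)
  have := (Submodule.mem_orthogonal' _ _).1 ha _ hmem
  rw [inner_sub_right, sub_eq_zero] at this
  exact this

end Unbounded

/-! ### From the uniform deviation to the stated bound -/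

section Assembly

variable {n K M : ℕ} (S : Matrix (Fin n) (Fin n) ℝ)

/-- The features `S^k x`, `k < K`, of a data point `(x, y)`. -/
def features (K : ℕ) {n : ℕ} (S : Matrix (Fin n) (Fin n) ℝ) (z : Vec n × Vec n) :
    Fin K → Vec n := fun k => shiftPow S k z.1

theorem measurable_features (k : Fin K) : Measurable fun z => features K S z k := by
  have h1 : Continuous fun x : Vec n => shiftPow S k x := by
    unfold shiftPow
    fun_prop
  exact h1.measurable.comp measurable_fst

theorem loss_eq (h : Vec K) (z : Vec n × Vec n) :
    loss S h z = ‖comb (features K S z) h - z.2‖ ^ 2 := rfl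

theorem ae_abs_loss_le_iff (D : Measure (Vec n × Vec n)) {ρ : ℝ} (hρ : 0 ≤ ρ) (h : Vec K) :
    (∀ᵐ z ∂D, |loss S h z| ≤ ρ ^ 2) ↔ ∀ᵐ z ∂D, ‖comb (features K S z) h - z.2‖ ≤ ρ := by
  refine eventually_congr (Eventually.of_forall fun z => ?_)
  rw [loss_eq, abs_of_nonneg (sq_nonneg _), sq_le_sq₀ (norm_nonneg _) hρ]

theorem sqSize_features_le (z : Fin M → Vec n × Vec n) (i : Fin M) :
    sqSize (features K S (z i)) ≤ K * maxShiftSq K S z := by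
  have h1 : ∀ k : Fin K, ‖features K S (z i) k‖ ^ 2 ≤ maxShiftSq K S z := fun k =>
    le_ciSup (f := fun q : Fin K × Fin M => ‖shiftPow S q.1 (z q.2).1‖ ^ 2)
      (Set.finite_range _).bddAbove (k, i)
  calc sqSize (features K S (z i)) ≤ ∑ _k : Fin K, maxShiftSq K S z :=
        Finset.sum_le_sum fun k _ => h1 k
    _ = _ := by simp

theorem popLoss_sub_sampleLoss_le_sq {D : Measure (Vec n × Vec n)} [IsProbabilityMeasure D] {ρ : ℝ}
    {h : Vec K} (hh : ∀ᵐ z ∂D, |loss S h z| ≤ ρ ^ 2) (z : Fin M → Vec n × Vec n) :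
    popLoss S D h - sampleLoss S z h ≤ ρ ^ 2 := by
  have h0 : 0 ≤ sampleLoss S z h :=
    mul_nonneg (by positivity) (Finset.sum_nonneg fun i _ => sq_nonneg _)
  have h1 : popLoss S D h ≤ ρ ^ 2 := by
    refine (le_abs_self _).trans ?_
    have := norm_integral_le_of_norm_le_const (μ := D) (f := fun z => loss S h z) hh
    simpa [popLoss] using this
  linarith

/-- The bound of the theorem in terms of `R = √(K max ‖S^k xᵢ‖² · ỹᵀ Θ̃† ỹ) / ρ`. -/
theorem le_genBound {ρ δ R G : ℝ} (hρ : 0 < ρ) (z : Fin M → Vec n × Vec n) (hM : 0 < M)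
    {Θ : Matrix (Fin M × Fin n) (Fin M × Fin n) ℝ} (hR : 0 ≤ R)
    (hRe : R ^ 2 * ρ ^ 2 =
      K * maxShiftSq K S z * (stackedOutput z ⬝ᵥ (pinv Θ *ᵥ stackedOutput z)))
    (hG : G ≤ ρ ^ 2 * (2.828 * R + 5.656 * √(Real.log (4 / δ))) / √M) :
    G ≤ genBound K S ρ δ z Θ := by
  have hM' : (0 : ℝ) < M := by exact_mod_cast hM
  have hs2 : 1.414 ≤ √2 := Real.le_sqrt_of_sq_le (by norm_num)
  have e1 : √(2 * K * maxShiftSq K S z * (stackedOutput z ⬝ᵥ (pinv Θ *ᵥ stackedOutput z)) / M)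
      = √2 * (R * ρ) / √M := by
    have : 2 * K * maxShiftSq K S z * (stackedOutput z ⬝ᵥ (pinv Θ *ᵥ stackedOutput z))
        = 2 * (R * ρ) ^ 2 := by rw [mul_pow, hRe]; ring
    rw [this, Real.sqrt_div' _ hM'.le, Real.sqrt_mul (by norm_num), Real.sqrt_sq (by positivity)]
  have e2 : √(2 * Real.log (4 / δ) / M) = √2 * √(Real.log (4 / δ)) / √M := by
    rw [Real.sqrt_div' _ hM'.le, Real.sqrt_mul (by norm_num)]
  rw [genBound, e1, e2]
  refine hG.trans ?_
  have e3 : 2 * ρ * (√2 * (R * ρ) / √M) + 4 * ρ ^ 2 * (√2 * √(Real.log (4 / δ)) / √M)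
      = ρ ^ 2 * (2 * √2 * R + 4 * √2 * √(Real.log (4 / δ))) / √M := by ring
  rw [e3]
  gcongr <;> linarith

/-- The deterministic part: a parameter which satisfies the uniform deviation bound satisfies the
generalization bound. -/
theorem deviation_le_genBound {D : Measure (Vec n × Vec n)} [IsProbabilityMeasure D]
    {ρ δ t C : ℝ} (hρ : 0 < ρ) (hδ : 0 < δ) (hδ1 : δ ≤ 1) (hM : 0 < M)
    {z : Fin M → Vec n × Vec n} {Θ : Matrix (Fin M × Fin n) (Fin M × Fin n) ℝ} {h h₀ : Vec K}
    (ht0 : 0 ≤ t) (htC : t ≤ C) (hti : ∃ i, t ≤ sqSize (features K S (z i)))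
    (hQ : 0 ≤ stackedOutput z ⬝ᵥ (pinv Θ *ᵥ stackedOutput z))
    (hh : ‖h‖ ≤ ‖h₀‖ + √(stackedOutput z ⬝ᵥ (pinv Θ *ᵥ stackedOutput z)))
    (hh₀ : √C * ‖h₀‖ ≤ 0.1 * ρ) (hloss : ∀ᵐ z ∂D, |loss S h z| ≤ ρ ^ 2)
    (hdev : 2 * (√t * ‖h‖ / ρ) ^ 2 + 7 * Real.log (4 / δ) ≤ 0.26 * M →
      popLoss S D h - sampleLoss S z h
        ≤ ρ ^ 2 * (2.75 * (√t * ‖h‖ / ρ) + 4.7 * √(Real.log (4 / δ))) / √M) :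
    popLoss S D h - sampleLoss S z h ≤ genBound K S ρ δ z Θ := by
  have hM' : (0 : ℝ) < M := by exact_mod_cast hM
  have hL1 : 1 ≤ Real.log (4 / δ) := by
    rw [Real.le_log_iff_exp_le (by positivity), le_div_iff₀ hδ]
    nlinarith [Real.exp_one_lt_d9, Real.exp_pos 1]
  set L := Real.log (4 / δ)
  set B := stackedOutput z ⬝ᵥ (pinv Θ *ᵥ stackedOutput z)
  set m := K * maxShiftSq K S z
  obtain ⟨i, hi⟩ := hti
  have htm : t ≤ m := hi.trans (sqSize_features_le S z i)
  have hm0 : 0 ≤ m := ht0.trans htm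
  set R := √m * √B / ρ with hR
  have hR0 : 0 ≤ R := by positivity
  have hRe : R ^ 2 * ρ ^ 2 = m * B := by
    rw [hR, div_pow, mul_pow, Real.sq_sqrt hm0, Real.sq_sqrt hQ]
    field_simp
  set γ := √t * ‖h‖ / ρ with hγ
  have hγ0 : 0 ≤ γ := by positivity
  have hγR : γ ≤ R + 0.1 := by
    rw [hγ, hR, div_le_iff₀ hρ, add_mul, div_mul_cancel₀ _ hρ.ne']
    calc √t * ‖h‖ ≤ √t * (‖h₀‖ + √B) := by gcongr
      _ = √t * √B + √t * ‖h₀‖ := by ring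
      _ ≤ √m * √B + √C * ‖h₀‖ := by gcongr
      _ ≤ _ := by gcongr
  set a := √L
  have ha1 : 1 ≤ a := Real.one_le_sqrt.2 hL1
  have ha2 : a ^ 2 = L := Real.sq_sqrt (by linarith)
  set q := √(M : ℝ) with hq
  have hq2 : q ^ 2 = M := Real.sq_sqrt hM'.le
  have hq0 : 0 < q := Real.sqrt_pos.2 hM'
  refine le_genBound S hρ z hM hR0 hRe ?_
  -- If √M is this small, the claimed bound already exceeds ρ², which bounds the population loss.
  rcases le_or_gt q (2.828 * R + 5.656 * a) with hc | hc
  · refine (popLoss_sub_sampleLoss_le_sq S hloss z).trans ?_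
    rw [le_div_iff₀ hq0]
    gcongr
  · refine (hdev ?_).trans ?_
    -- Otherwise M is large enough for the uniform bound: 0.26 · 2.828² > 2 and 0.26 · 5.656² > 8,
    -- and the surplus over 7L and the mixed term absorb the shift by 0.1.
    · rw [← hq2, ← ha2]
      have k1 : γ ^ 2 ≤ (R + 0.1) ^ 2 := by gcongr
      have k2 : (2.828 * R + 5.656 * a) ^ 2 ≤ q ^ 2 := by gcongr
      nlinarith [mul_nonneg hR0 (by linarith : 0 ≤ a - 1)]
    -- The initialization contributes 2.75 · 0.1, which is below (5.656 - 4.7)√L since L ≥ 1.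
    · gcongr ρ ^ 2 * ?_ / _
      linarith

/-- A single admissible predictor bounds the outputs when the features are bounded. So unbounded
outputs leave no admissible predictor at all. -/
theorem ae_bound_output {D : Measure (Vec n × Vec n)} {ρ C : ℝ} (hC0 : 0 ≤ C)
    (hC : ∀ᵐ z ∂D, sqSize (features K S z) ≤ C) {h : Vec K}
    (hh : ∀ᵐ z ∂D, ‖comb (features K S z) h - z.2‖ ≤ ρ) :
    ∃ Y, ∀ᵐ z ∂D, ‖z.2‖ ≤ Y := by
  refine ⟨√C * ‖h‖ + ρ, ?_⟩
  filter_upwards [hC, hh] with z h1 h2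
  have h3 : ‖comb (features K S z) h‖ ≤ √C * ‖h‖ := by
    refine le_of_sq_le_sq ((norm_comb_sq_le _ _).trans ?_) (by positivity)
    rw [mul_pow, Real.sq_sqrt hC0]
    gcongr
  calc ‖z.2‖ = ‖comb (features K S z) h - (comb (features K S z) h - z.2)‖ := by
        rw [sub_sub_cancel]
    _ ≤ _ := (norm_sub_le _ _).trans (add_le_add h3 h2)

/-- The product formula for rectangles holds without measurability, so the exceptional events need
not be shown measurable. -/
theorem measure_prod_union_le {Ω Ω' : Type*} [MeasurableSpace Ω] [MeasurableSpace Ω']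
    {μ : Measure Ω} {ν : Measure Ω'} [IsProbabilityMeasure μ] [IsProbabilityMeasure ν]
    {A : Set Ω} {B : Set Ω'} {a b : ℝ≥0∞} (hA : μ A ≤ a) (hB : ν B ≤ b) :
    (μ.prod ν) (A ×ˢ Set.univ ∪ Set.univ ×ˢ B) ≤ a + b := by
  refine (measure_union_le _ _).trans (add_le_add ?_ ?_)
  · rwa [Measure.prod_prod, measure_univ, mul_one]
  · rwa [Measure.prod_prod, measure_univ, one_mul]

theorem mem_trained_zero (z : Fin M → Vec n × Vec n) (η : ℝ) (h₀ : Vec K) :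
    h₀ ∈ trained (graphFilter K S) z η h₀ := Or.inl ⟨0, rfl⟩

end Assembly

end GraphNTK

end

/-! ### The main theorem -/

open GraphNTK in
theorem theorem4 (n K : ℕ) (S : Matrix (Fin n) (Fin n) ℝ) (hS : S.IsSymm)
    (D : Measure (Vec n × Vec n)) [IsProbabilityMeasure D] (ρ : ℝ) (hρ : 0 ≤ ρ) :
    ∃ ε : ℝ, 0 < ε ∧
      ∀ (M : ℕ) (δ₁ δ₂ κ : ℝ), 0 < M → 0 < δ₁ → 0 < δ₂ → δ₁ + δ₂ < 1 →
        0 < κ → κ ≤ ε * √(δ₁ / (n * M)) →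
        ((Measure.pi fun _ : Fin M => D).prod (initLaw K κ))
          {ω : (Fin M → Vec n × Vec n) × Vec K | ¬ ∀ η : ℝ, 0 < η →
            η * ‖Matrix.toEuclideanCLM (𝕜 := ℝ) (ntk (graphFilter K S) ω.1 ω.2)‖ ≤ 1 →
            (∀ h ∈ trained (graphFilter K S) ω.1 η ω.2, ∀ᵐ z ∂D, |loss S h z| ≤ ρ ^ 2) →
            (∀ h ∈ trained (graphFilter K S) ω.1 η ω.2,
              popLoss S D h - sampleLoss S ω.1 h ≤
                genBound K S ρ δ₂ ω.1 (ntk (graphFilter K S) ω.1 ω.2)) ∧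
            (∀ h ∈ trained (graphFilter K S) ω.1 η ω.2,
              IsMinOn (sampleLoss S ω.1) (trained (graphFilter K S) ω.1 η ω.2) h →
              popLoss S D h - sampleLoss S ω.1 h ≤
                genBound K S ρ δ₂ ω.1 (ntk (graphFilter K S) ω.1 ω.2))}
          ≤ ENNReal.ofReal (δ₁ + δ₂) := by
  rcases hρ.eq_or_lt with hρ0 | hρ0
  · refine ⟨1, one_pos, fun M δ₁ δ₂ κ hM hδ₁ hδ₂ hδ hκ hκε => ?_⟩
    refine le_trans (le_of_eq ?_) zero_le
    refine measure_mono_null (t := ∅) (fun ω hω => (hω fun η hη hηΘ hloss => ?_).elim) measure_empty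
    have h1 : ∀ h ∈ trained (graphFilter K S) ω.1 η ω.2, popLoss S D h - sampleLoss S ω.1 h ≤
        genBound K S ρ δ₂ ω.1 (ntk (graphFilter K S) ω.1 ω.2) := by
      intro h hh
      refine (popLoss_sub_sampleLoss_le_sq S (hloss h hh) ω.1).trans ?_
      rw [← hρ0]
      simp [genBound]
    exact ⟨h1, fun h hh _ => h1 h hh⟩
  -- With unbounded features the premise fails almost surely already at step 0, because h₀ itself is
  -- a trained parameter.
  by_cases hW : boundedDirections (features K S) D = ⊤
  swap
  · refine ⟨1, one_pos, fun M δ₁ δ₂ κ hM hδ₁ hδ₂ hδ hκ hκε => ?_⟩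
    refine le_trans (le_of_eq ?_) zero_le
    have hnull := initLaw_admissible_eq_zero (features K S) (fun z => z.2) D hW hκ ρ
    refine measure_mono_null (t := Set.univ ×ˢ
      {h | ∀ᵐ z ∂D, ‖comb (features K S z) h - z.2‖ ≤ ρ}) (fun ω hω => ?_) ?_
    · refine ⟨Set.mem_univ _, ?_⟩
      by_contra hcon
      refine hω fun η hη hηΘ hloss => (hcon ?_).elim
      exact (ae_abs_loss_le_iff S D hρ _).1 (hloss _ (mem_trained_zero S _ _ _))
    · rw [Measure.prod_prod, hnull, mul_zero]
  obtain ⟨C, hC0, hC⟩ := exists_bound_of_boundedDirections_eq_top _ D hW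
  set c : ℝ := √C * √K + 1 with hc
  have hc0 : 0 < c := by positivity
  -- This choice gives √C‖h₀‖ ≤ 0.1ρ with probability at least 1 - δ₁. The summand 1 in `c` only
  -- keeps it positive.
  refine ⟨0.1 * ρ / c, by positivity, fun M δ₁ δ₂ κ hM hδ₁ hδ₂ hδ hκ hκε => ?_⟩
  by_cases hY : ∃ Y, ∀ᵐ z ∂D, ‖z.2‖ ≤ Y
  swap
  · refine le_trans (le_of_eq ?_) zero_le
    refine measure_mono_null (t := ∅)
      (fun ω hω => (hω fun η hη hηΘ hloss => (hY ?_).elim).elim) measure_empty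
    exact ae_bound_output S hC0 hC
      ((ae_abs_loss_le_iff S D hρ _).1 (hloss _ (mem_trained_zero S _ _ _)))
  obtain ⟨Y, hY⟩ := hY
  obtain ⟨t, ht0, htC, hdev⟩ := exists_uniform_deviation D (measurable_features S)
    measurable_snd hC0 hC hY hρ0 hM hδ₂ (by linarith)
  have hinit := initLaw_norm_gt_le (K := K) hκ hδ₁
  have hM' : (1 : ℝ) ≤ M := by exact_mod_cast hM
  -- For n = 0 the quotient δ₁/(nM) is 0 by convention, which would force κ ≤ 0.
  have hn : (1 : ℝ) ≤ n := by
    rcases Nat.eq_zero_or_pos n with h0 | h0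
    · rw [h0] at hκε; simp at hκε; linarith
    · exact_mod_cast h0
  have hsmall : √C * (κ * √(K / δ₁)) ≤ 0.1 * ρ := by
    have h1 : κ * √(K / δ₁) ≤ 0.1 * ρ / c * √K := by
      have h2 : √(δ₁ / (n * M)) ≤ √δ₁ := by
        refine Real.sqrt_le_sqrt (div_le_self hδ₁.le ?_)
        nlinarith
      have h3 : κ ≤ 0.1 * ρ / c * √δ₁ := hκε.trans (by gcongr)
      calc κ * √(K / δ₁) ≤ 0.1 * ρ / c * √δ₁ * √(K / δ₁) := by gcongr
        _ = _ := by
          rw [mul_assoc, ← Real.sqrt_mul hδ₁.le, mul_div_cancel₀ _ hδ₁.ne']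
    calc √C * (κ * √(K / δ₁)) ≤ √C * (0.1 * ρ / c * √K) := by gcongr
      _ = 0.1 * ρ * ((√C * √K) / c) := by ring
      _ ≤ 0.1 * ρ * 1 := by
          gcongr
          rw [div_le_one hc0, hc]; linarith
      _ = _ := mul_one _
  have hunion := measure_prod_union_le hdev hinit
  rw [← ENNReal.ofReal_add hδ₂.le hδ₁.le, add_comm δ₂] at hunion
  refine (measure_mono fun ω hω => ?_).trans hunion
  by_contra hcon
  rw [Set.mem_union, not_or] at hcon
  obtain ⟨hti, hd⟩ := not_not.1 fun hA => hcon.1 ⟨hA, Set.mem_univ _⟩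
  have h0 : ‖ω.2‖ ≤ κ * √(K / δ₁) := not_lt.1 fun hB => hcon.2 ⟨Set.mem_univ _, hB⟩
  refine hω fun η hη hηΘ hloss => ?_
  have h1 : ∀ h ∈ trained (graphFilter K S) ω.1 η ω.2, popLoss S D h - sampleLoss S ω.1 h ≤
      genBound K S ρ δ₂ ω.1 (ntk (graphFilter K S) ω.1 ω.2) := by
    intro h hh
    obtain ⟨hQ, hnorm⟩ := norm_trained_le S ω.1 hη ω.2 hηΘ hh
    refine deviation_le_genBound S hρ0 hδ₂ (by linarith) hM ht0 htC hti hQ hnorm ?_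
      (hloss h hh) (hd h ((ae_abs_loss_le_iff S D hρ h).1 (hloss h hh)))
    exact (mul_le_mul_of_nonneg_left h0 (Real.sqrt_nonneg _)).trans hsmall
  exact ⟨h1, fun h hh _ => h1 h hh⟩
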